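/- **Setting.** Let $P_1,P_2,N>0$. All logarithms are natural and a rate pair is a pair $(R_1,R_2)$ of nonnegative reals. *Channel.* Consider the two-user channel $Y_t=X_{1,t}+X_{2,t}+Z_t$ with feedback outputs $V_{\nu,t}=Y_t+W_{\nu,t}$, $\nu\in\{1,2\}$, where $(Z_t)$ is IID $\mathcal N(0,N)$ and, independently, $((W_{1,t},W_{2,t}))$ is IID centered bivariate Gaussian with covariance matrix $\mathsf K$. A blocklength-$n$ feedback code consists of (measurable) encoders $X_{\nu,t}=\varphi_{\nu,t}(M_\nu,V_{\nu,1},\dots,V_{\nu,t-1})$ with independent messages $M_\nu$ uniform on finite sets $\mathcal M_\nu$ and independent of the noise, subject to $\frac1n\sum_{t=1}^n E[X_{\nu,t}^2]\le P_\nu$, and a (measurable) decoder $(Y_1,\dots,Y_n)\mapsto(\hat M_1,\hat M_2)$. A rate pair $(R_1,R_2)$ is achievable if for every $\delta>0$ there are such codes, for all sufficiently large $n$, with $\frac1n\log|\mathcal M_\nu|>R_\nu-\delta$ for $\nu=1,2$ and with average probability of decoding error tending to $0$ as $n\to\infty$. The set of achievable rate pairs for $\mathsf K=0$ is the perfect-feedback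 capacity region $\mathcal C_{\rm PerfectFB}(P_1,P_2,N)$. *Ozarow's rectangles.* Let $\rho^*=\rho^*(P_1,P_2,N)$ be the unique solution in $[0,1]$ of $$N\big(N+P_1+P_2+2\sqrt{P_1P_2}\,\rho\big)=\big(N+P_1(1-\rho^2)\big)\big(N+P_2(1-\rho^2)\big).$$ For $\rho\in[0,\rho^*]$ let $\mathcal R^\rho_{1,\rm Oz}(P_1,P_2,N)$ be the set of rate pairs with $$R_1\le\tfrac12\log\Big(1+\tfrac{P_1(1-\rho^2)}N\Big),\qquad R_2\le\tfrac12\log\frac{P_1+P_2+2\sqrt{P_1P_2}\,\rho+N}{P_1(1-\rho^2)+N},$$ and $\mathcal R^\rho_{2,\rm Oz}(P_1,P_2,N)$ the set of rate pairs with $$R_1\le\tfrac12\log\frac{P_1+P_2+2\sqrt{P_1P_2}\,\rho+N}{P_2(1-\rho^2)+N},\qquad R_2\le\tfrac12\log\Big(1+\tfrac{P_2(1-\rho^2)}N\Big).$$ *Concatenated-scheme regions.* Let $\eta\ge1$, $a_1,a_2\in\mathbb R^\eta$, let $B_1,B_2$ be strictly lower-triangular $\eta\times\eta$ matrices, let $C\in\mathbb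 R^{2\times\eta}$, and let $\mathsf K\succeq0$ be $2\times2$. Put $A=(a_1\ a_2)$, $\bar B=(B_1\ B_2)$ and $Q_{N,\mathsf K}=N I_\eta+\bar B(\mathsf K\otimes I_\eta)\bar B^{\mathsf T}$. If $CC^{\mathsf T}$ is nonsingular, $\mathcal R_{N,\mathsf K}(\eta,a_1,a_2,B_1,B_2,C)$ is the set of rate pairs with $$R_\nu\le\frac1{2\eta}\log\frac{|C(a_\nu a_\nu^{\mathsf T}+Q_{N,\mathsf K})C^{\mathsf T}|}{|CQ_{N,\mathsf K}C^{\mathsf T}|}\ (\nu=1,2),\qquad R_1+R_2\le\frac1{2\eta}\log\frac{|C(AA^{\mathsf T}+Q_{N,\mathsf K})C^{\mathsf T}|}{|CQ_{N,\mathsf K}C^{\mathsf T}|};$$ if $CC^{\mathsf T}$ is singular but $C\ne0$, it is defined by the same inequalities with $C$ replaced by one of its nonzero rows; if $C=0$, it is $\{(0,0)\}$. The parameters satisfy the trace constraints for $(P_1,P_2,N,\mathsf K)$ if, for $\nu=1,2$, the $\nu$-th diagonal $\eta\times\eta$ block of $$(I_{2\eta}-\mathbf B)^{-1}\Big(A_dA_d^{\mathsf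 T}+N\begin{pmatrix}B_1\\B_2\end{pmatrix}\begin{pmatrix}B_1\\B_2\end{pmatrix}^{\mathsf T}+B_d(\mathsf K\otimes I_\eta)B_d^{\mathsf T}\Big)(I_{2\eta}-\mathbf B)^{-\mathsf T},\quad \mathbf B=\begin{pmatrix}B_1&B_1\\B_2&B_2\end{pmatrix},\ A_d=\begin{pmatrix}a_1&0\\0&a_2\end{pmatrix},\ B_d=\begin{pmatrix}B_1&0\\0&B_2\end{pmatrix},$$ has trace at most $\eta P_\nu$. *Rate-splitting regions.* $\mathcal R_{\rm RS,1}(P_1',P_1'',P_2,N,\mathsf K)$ is the closure of the union, over all $(\eta,a_1,a_2,B_1,B_2,C)$ satisfying the trace constraints for $(P_1'',P_2,N+P_1',\mathsf K)$, of the sets of pairs $(R_{\rm CS}+R_{\rm NF},R_2)$ with $R_{\rm CS},R_{\rm NF}\ge0$, $(R_{\rm CS},R_2)\in\mathcal R_{N+P_1',\mathsf K}(\eta,a_1,a_2,B_1,B_2,C)$ and $$R_{\rm NF}\le\frac1{2\eta}\log\frac{|P_1'I_\eta+Q_{N,\mathsf K}|}{|Q_{N,\mathsf K}|}.$$ $\mathcal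 R_{\rm RS,2}(P_1,P_2',P_2'',N,\mathsf K)$ is defined in the same way with the roles of the two users exchanged (trace constraints for $(P_1,P_2'',N+P_2',\mathsf K)$, and $R_2$ split). **Proposition (Convergence to the boundary of $\mathcal C_{\rm PerfectFB}$).** 1. For every $\rho\in[0,\rho^*]$ there is $P_1'(\rho)\in[0,P_1]$ such that $$\mathrm{cl}\Big(\bigcup_{\sigma^2>0}\ \bigcap_{\mathsf K\succeq0,\ \mathrm{tr}\,\mathsf K\le\sigma^2}\mathcal R_{\rm RS,1}\big(P_1'(\rho),P_1-P_1'(\rho),P_2,N,\mathsf K\big)\Big)\supseteq\mathcal R^\rho_{1,\rm Oz}(P_1,P_2,N).$$ 2. For every $\rho\in[0,\rho^*]$ there is $P_2'(\rho)\in[0,P_2]$ such that $$\mathrm{cl}\Big(\bigcup_{\sigma^2>0}\ \bigcap_{\mathsf K\succeq0,\ \mathrm{tr}\,\mathsf K\le\sigma^2}\mathcal R_{\rm RS,2}\big(P_1,P_2'(\rho),P_2-P_2'(\rho),N,\mathsf K\big)\Big)\supseteq\mathcal R^\rho_{2,\rm Oz}(P_1,P_2,N).$$ 3. Consequently the rate-splitting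 regions asymptotically approach all boundary points of $\mathcal C_{\rm PerfectFB}(P_1,P_2,N)$: every boundary point (in $\mathbb R^2$) of $\mathcal C_{\rm PerfectFB}(P_1,P_2,N)$ belongs, for some $P_1'\in[0,P_1]$, to $\mathrm{cl}\big(\bigcup_{\sigma^2>0}\bigcap_{\mathsf K\succeq0,\,\mathrm{tr}\,\mathsf K\le\sigma^2}\mathcal R_{\rm RS,1}(P_1',P_1-P_1',P_2,N,\mathsf K)\big)$ or, for some $P_2'\in[0,P_2]$, to $\mathrm{cl}\big(\bigcup_{\sigma^2>0}\bigcap_{\mathsf K\succeq0,\,\mathrm{tr}\,\mathsf K\le\sigma^2}\mathcal R_{\rm RS,2}(P_1,P_2',P_2-P_2',N,\mathsf K)\big)$. -/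

import Mathlib

open scoped Matrix Kronecker Topology

noncomputable section

namespace AWGNMAC

/-! ### The two-user Gaussian multiple-access channel with noisy feedback

Users are indexed by `Fin 2` (index `0` is Transmitter 1, index `1` is Transmitter 2).
All logarithms are natural. A rate pair is a pair of nonnegative reals. -/

/-- A blocklength-`n` feedback code with message sets of sizes `M 0` and `M 1`: at time `t`,
Transmitter `ν` maps its message and its `t` previous feedback outputs to a channel input. -/
structure FeedbackCode (n : ℕ) (M : Fin 2 → ℕ) where
  card_pos : ∀ ν, 0 < M ν
  enc : (ν : Fin 2) → (t : Fin n) → Fin (M ν) → (Fin (t : ℕ) → ℝ) → ℝ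
  dec : (Fin n → ℝ) → ((ν : Fin 2) → Fin (M ν))
  measurable_enc : ∀ ν t m, Measurable (enc ν t m)
  measurable_dec : Measurable dec

namespace FeedbackCode

variable {n : ℕ} {M : Fin 2 → ℕ}

/-- The channel output `Y_t = X_{1,t} + X_{2,t} + Z_t`, where `X_{ν,t}` is computed from the
message and the previous feedback outputs `V_{ν,s} = Y_s + W_{ν,s}`, `s < t`. -/
def output (c : FeedbackCode n M) (m : (ν : Fin 2) → Fin (M ν)) (z : Fin n → ℝ)
    (w : Fin n → EuclideanSpace ℝ (Fin 2)) (t : Fin n) : ℝ :=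
  (∑ ν : Fin 2, c.enc ν t (m ν) fun s : Fin (t : ℕ) =>
    c.output m z w ⟨s, s.2.trans t.2⟩ + w ⟨s, s.2.trans t.2⟩ ν) + z t
termination_by (t : ℕ)
decreasing_by exact s.2

/-- The channel input `X_{ν,t}`. -/
def input (c : FeedbackCode n M) (m : (ν : Fin 2) → Fin (M ν)) (z : Fin n → ℝ)
    (w : Fin n → EuclideanSpace ℝ (Fin 2)) (ν : Fin 2) (t : Fin n) : ℝ :=
  c.enc ν t (m ν) fun s : Fin (t : ℕ) =>
    c.output m z w ⟨s, s.2.trans t.2⟩ + w ⟨s, s.2.trans t.2⟩ ν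

end FeedbackCode

/-- The law of the noise: `Z_t` IID centered Gaussian of variance `N` and, independently,
`(W_{1,t}, W_{2,t})` IID centered bivariate Gaussian with covariance matrix `K`. -/
def noiseLaw (n : ℕ) (N : ℝ) (K : Matrix (Fin 2) (Fin 2) ℝ) :
    MeasureTheory.Measure ((Fin n → ℝ) × (Fin n → EuclideanSpace ℝ (Fin 2))) :=
  (MeasureTheory.Measure.pi fun _ => ProbabilityTheory.gaussianReal 0 N.toNNReal).prod
    (MeasureTheory.Measure.pi fun _ => ProbabilityTheory.multivariateGaussian 0 K)

namespace FeedbackCode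

variable {n : ℕ} {M : Fin 2 → ℕ}

/-- Expected average block-power constraint of Transmitter `ν`, the expectation being over
uniform independent messages and over the noise. -/
def PowerConstraint (c : FeedbackCode n M) (N : ℝ) (K : Matrix (Fin 2) (Fin 2) ℝ)
    (ν : Fin 2) (P : ℝ) : Prop :=
  (∀ m t, MeasureTheory.MemLp (fun ω => c.input m ω.1 ω.2 ν t) 2 (noiseLaw n N K)) ∧
  (1 / (n : ℝ)) * ∑ t : Fin n, (1 / ((M 0 : ℝ) * M 1)) * ∑ m : (ν : Fin 2) → Fin (M ν),
    ∫ ω, (c.input m ω.1 ω.2 ν t) ^ 2 ∂(noiseLaw n N K) ≤ P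

/-- Average probability of a decoding error. -/
def errorProb (c : FeedbackCode n M) (N : ℝ) (K : Matrix (Fin 2) (Fin 2) ℝ) : ℝ :=
  (1 / ((M 0 : ℝ) * M 1)) * ∑ m : (ν : Fin 2) → Fin (M ν),
    (noiseLaw n N K).real {ω | c.dec (c.output m ω.1 ω.2) ≠ m}

end FeedbackCode

/-- The capacity region with noisy feedback: the set of all achievable rate pairs. -/
def capNoisyFB (P₁ P₂ N : ℝ) (K : Matrix (Fin 2) (Fin 2) ℝ) : Set (ℝ × ℝ) :=
  {R | 0 ≤ R.1 ∧ 0 ≤ R.2 ∧ ∀ δ > 0,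
    ∃ (M : ℕ → Fin 2 → ℕ) (c : (n : ℕ) → FeedbackCode n (M n)),
      (∀ᶠ n : ℕ in Filter.atTop,
        (c n).PowerConstraint N K 0 P₁ ∧ (c n).PowerConstraint N K 1 P₂ ∧
        R.1 - δ < (1 / (n : ℝ)) * Real.log (M n 0) ∧
        R.2 - δ < (1 / (n : ℝ)) * Real.log (M n 1)) ∧
      Filter.Tendsto (fun n => (c n).errorProb N K) Filter.atTop (𝓝 0)}

/-- The capacity region with perfect (noise-free) feedback. -/
def capPerfectFB (P₁ P₂ N : ℝ) : Set (ℝ × ℝ) := capNoisyFB P₁ P₂ N 0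

/-! ### Ozarow's rectangles -/

/-- The defining equation of `ρ*`. -/
def RhoEq (P₁ P₂ N ρ : ℝ) : Prop :=
  N * (N + P₁ + P₂ + 2 * √(P₁ * P₂) * ρ) =
    (N + P₁ * (1 - ρ ^ 2)) * (N + P₂ * (1 - ρ ^ 2))

theorem existsUnique_rhoEq {P₁ P₂ N : ℝ} (h₁ : 0 < P₁) (h₂ : 0 < P₂) (hN : 0 < N) :
    ∃! ρ : ℝ, ρ ∈ Set.Icc (0 : ℝ) 1 ∧ RhoEq P₁ P₂ N ρ := by
  have hs : 0 < √(P₁ * P₂) := Real.sqrt_pos.2 (mul_pos h₁ h₂)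
  have hanti : StrictAntiOn (fun ρ : ℝ => (N + P₁ * (1 - ρ ^ 2)) * (N + P₂ * (1 - ρ ^ 2))
      - N * (N + P₁ + P₂ + 2 * √(P₁ * P₂) * ρ)) (Set.Icc 0 1) := by
    intro x hx y hy hxy
    have hsq : x ^ 2 ≤ y ^ 2 := pow_le_pow_left₀ hx.1 hxy.le 2
    have hy2 : y ^ 2 ≤ 1 := pow_le_one₀ hy.1 hy.2
    have e1 : (N + P₁ * (1 - y ^ 2)) * (N + P₂ * (1 - y ^ 2)) ≤
        (N + P₁ * (1 - x ^ 2)) * (N + P₂ * (1 - x ^ 2)) := by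
      apply mul_le_mul
      · nlinarith
      · nlinarith
      · nlinarith
      · nlinarith
    have e2 : N * (2 * √(P₁ * P₂) * x) < N * (2 * √(P₁ * P₂) * y) := by gcongr
    simp only
    nlinarith
  have hcont : ContinuousOn (fun ρ : ℝ => (N + P₁ * (1 - ρ ^ 2)) * (N + P₂ * (1 - ρ ^ 2))
      - N * (N + P₁ + P₂ + 2 * √(P₁ * P₂) * ρ)) (Set.Icc 0 1) := by fun_prop
  have h0 : (0 : ℝ) ∈ Set.Icc
      ((fun ρ : ℝ => (N + P₁ * (1 - ρ ^ 2)) * (N + P₂ * (1 - ρ ^ 2))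
      - N * (N + P₁ + P₂ + 2 * √(P₁ * P₂) * ρ)) 1)
      ((fun ρ : ℝ => (N + P₁ * (1 - ρ ^ 2)) * (N + P₂ * (1 - ρ ^ 2))
      - N * (N + P₁ + P₂ + 2 * √(P₁ * P₂) * ρ)) 0) := by
    have := mul_pos h₁ h₂
    have := mul_pos hN hs
    have := mul_pos hN h₁
    have := mul_pos hN h₂
    constructor <;> simp only <;> nlinarith
  obtain ⟨ρ, hρ, hρ0⟩ := intermediate_value_Icc' zero_le_one hcont h0
  refine ⟨ρ, ⟨hρ, (sub_eq_zero.1 hρ0).symm⟩, ?_⟩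
  rintro y ⟨hy, hye⟩
  exact hanti.injOn hy hρ (Eq.trans (sub_eq_zero.2 (Eq.symm hye)) hρ0.symm)

/-- `ρ*(P₁, P₂, N)`: the solution of `RhoEq` in `[0, 1]`; it exists and is unique for positive
`P₁, P₂, N` by `existsUnique_rhoEq`. -/
def rhoStar (P₁ P₂ N : ℝ) : ℝ :=
  Classical.epsilon fun ρ : ℝ => ρ ∈ Set.Icc (0 : ℝ) 1 ∧ RhoEq P₁ P₂ N ρ

theorem rhoStar_spec {P₁ P₂ N : ℝ} (h₁ : 0 < P₁) (h₂ : 0 < P₂) (hN : 0 < N) :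
    rhoStar P₁ P₂ N ∈ Set.Icc (0 : ℝ) 1 ∧ RhoEq P₁ P₂ N (rhoStar P₁ P₂ N) :=
  Classical.epsilon_spec (existsUnique_rhoEq h₁ h₂ hN).exists

/-- Ozarow's rectangle `R^ρ_{1,Oz}`. -/
def ozRect₁ (P₁ P₂ N ρ : ℝ) : Set (ℝ × ℝ) :=
  {R | 0 ≤ R.1 ∧ 0 ≤ R.2 ∧
    R.1 ≤ 1 / 2 * Real.log (1 + P₁ * (1 - ρ ^ 2) / N) ∧
    R.2 ≤ 1 / 2 * Real.log ((P₁ + P₂ + 2 * √(P₁ * P₂) * ρ + N) / (P₁ * (1 - ρ ^ 2) + N))}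

/-- Ozarow's rectangle `R^ρ_{2,Oz}`. -/
def ozRect₂ (P₁ P₂ N ρ : ℝ) : Set (ℝ × ℝ) :=
  {R | 0 ≤ R.1 ∧ 0 ≤ R.2 ∧
    R.1 ≤ 1 / 2 * Real.log ((P₁ + P₂ + 2 * √(P₁ * P₂) * ρ + N) / (P₂ * (1 - ρ ^ 2) + N)) ∧
    R.2 ≤ 1 / 2 * Real.log (1 + P₂ * (1 - ρ ^ 2) / N)}

/-! ### The concatenated scheme

Vectors of length `2η` are indexed by `Fin 2 × Fin η`: the entry `(ν, i)` is the `i`-th entry of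
the `ν`-th block of length `η`. -/

/-- Parameters of the scheme for a given `η`: vectors `a_ν`, strictly lower-triangular matrices
`B_ν`, and a `2 × η` matrix `C`. -/
structure Params (η : ℕ) where
  a : Fin 2 → Fin η → ℝ
  B : Fin 2 → Matrix (Fin η) (Fin η) ℝ
  C : Matrix (Fin 2) (Fin η) ℝ
  strictLower : ∀ ν i j, i ≤ j → B ν i j = 0

namespace Params

variable {η : ℕ}

/-- The `η × 2` matrix `(a₁ a₂)`. -/
def Ab (p : Params η) : Matrix (Fin η) (Fin 2) ℝ := Matrix.of fun i ν => p.a ν i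

/-- The `2η × 2` block-diagonal matrix with blocks `a₁, a₂`. -/
def Ad (p : Params η) : Matrix (Fin 2 × Fin η) (Fin 2) ℝ :=
  Matrix.of fun x μ => if x.1 = μ then p.a x.1 x.2 else 0

/-- The `η × 2η` matrix `(B₁ B₂)`. -/
def Bb (p : Params η) : Matrix (Fin η) (Fin 2 × Fin η) ℝ := Matrix.of fun i y => p.B y.1 i y.2

/-- The `2η × η` matrix with `B₁` on top of `B₂`. -/
def Bt (p : Params η) : Matrix (Fin 2 × Fin η) (Fin η) ℝ := Matrix.of fun x j => p.B x.1 x.2 j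

/-- The `2η × 2η` block-diagonal matrix with blocks `B₁, B₂`. -/
def Bd (p : Params η) : Matrix (Fin 2 × Fin η) (Fin 2 × Fin η) ℝ :=
  Matrix.of fun x y => if x.1 = y.1 then p.B x.1 x.2 y.2 else 0

/-- The `2η × 2η` matrix with block rows `(B₁ B₁)` and `(B₂ B₂)`. -/
def BB (p : Params η) : Matrix (Fin 2 × Fin η) (Fin 2 × Fin η) ℝ :=
  Matrix.of fun x y => p.B x.1 x.2 y.2

/-- `N I_η + (B₁ B₂)(K ⊗ I_η)(B₁ B₂)ᵀ`. -/
def noiseCov (p : Params η) (N : ℝ) (K : Matrix (Fin 2) (Fin 2) ℝ) :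
    Matrix (Fin η) (Fin η) ℝ :=
  N • (1 : Matrix (Fin η) (Fin η) ℝ) +
    p.Bb * (K ⊗ₖ (1 : Matrix (Fin η) (Fin η) ℝ)) * p.Bbᵀ

/-- `(1/(2η)) log (|D (S + Q) Dᵀ| / |D Q Dᵀ|)`, with `Q` the noise covariance. -/
def rateBound (p : Params η) (N : ℝ) (K : Matrix (Fin 2) (Fin 2) ℝ) {k : ℕ}
    (D : Matrix (Fin k) (Fin η) ℝ) (S : Matrix (Fin η) (Fin η) ℝ) : ℝ :=
  1 / (2 * (η : ℝ)) *
    Real.log ((D * (S + p.noiseCov N K) * Dᵀ).det / (D * p.noiseCov N K * Dᵀ).det)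

/-- The rate pairs satisfying the three rate constraints with decoding matrix `D`. -/
def constraintSet (p : Params η) (N : ℝ) (K : Matrix (Fin 2) (Fin 2) ℝ) {k : ℕ}
    (D : Matrix (Fin k) (Fin η) ℝ) : Set (ℝ × ℝ) :=
  {R | 0 ≤ R.1 ∧ 0 ≤ R.2 ∧
    R.1 ≤ p.rateBound N K D (Matrix.vecMulVec (p.a 0) (p.a 0)) ∧
    R.2 ≤ p.rateBound N K D (Matrix.vecMulVec (p.a 1) (p.a 1)) ∧
    R.1 + R.2 ≤ p.rateBound N K D (p.Ab * p.Abᵀ)}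

/-- The rate region of the concatenated scheme with parameters `p`. If `C Cᵀ` is singular but
`C ≠ 0`, the matrix `C` is replaced by one of its nonzero rows; if `C = 0`, the region is the
origin. -/
def region (p : Params η) (N : ℝ) (K : Matrix (Fin 2) (Fin 2) ℝ) : Set (ℝ × ℝ) :=
  {R | ((p.C * p.Cᵀ).det ≠ 0 ∧ R ∈ p.constraintSet N K p.C) ∨
    ((p.C * p.Cᵀ).det = 0 ∧ ∃ ν : Fin 2, p.C ν ≠ 0 ∧
      R ∈ p.constraintSet N K (Matrix.of fun _ : Fin 1 => p.C ν)) ∨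
    (p.C = 0 ∧ R = (0, 0))}

/-- The covariance matrix of the stacked channel inputs,
`(I - BB)⁻¹ (A_d A_dᵀ + N B_t B_tᵀ + B_d (K ⊗ I_η) B_dᵀ) (I - BB)⁻ᵀ`. -/
def inputCov (p : Params η) (N : ℝ) (K : Matrix (Fin 2) (Fin 2) ℝ) :
    Matrix (Fin 2 × Fin η) (Fin 2 × Fin η) ℝ :=
  (1 - p.BB)⁻¹ *
    (p.Ad * p.Adᵀ + N • (p.Bt * p.Btᵀ) +
      p.Bd * (K ⊗ₖ (1 : Matrix (Fin η) (Fin η) ℝ)) * p.Bdᵀ) *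
    ((1 - p.BB)⁻¹)ᵀ

/-- The two trace constraints: the trace of the `ν`-th diagonal `η × η` block of `inputCov` is
at most `η P_ν`. -/
def TraceConstraints (p : Params η) (P₁ P₂ N : ℝ) (K : Matrix (Fin 2) (Fin 2) ℝ) : Prop :=
  ((p.inputCov N K).submatrix (Prod.mk 0) (Prod.mk 0)).trace ≤ η * P₁ ∧
  ((p.inputCov N K).submatrix (Prod.mk 1) (Prod.mk 1)).trace ≤ η * P₂

/-- The bound on the rate `R_NF` of the part of the message sent without feedback, with
power `P'`. -/
def nfBound (p : Params η) (P' N : ℝ) (K : Matrix (Fin 2) (Fin 2) ℝ) : ℝ :=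
  1 / (2 * (η : ℝ)) *
    Real.log ((P' • (1 : Matrix (Fin η) (Fin η) ℝ) + p.noiseCov N K).det /
      (p.noiseCov N K).det)

/-- Rate-splitting region for fixed parameters, Transmitter 1 splitting its message. -/
def regionRS₁ (p : Params η) (P₁' N : ℝ) (K : Matrix (Fin 2) (Fin 2) ℝ) : Set (ℝ × ℝ) :=
  {R | ∃ Rcs Rnf : ℝ, 0 ≤ Rcs ∧ 0 ≤ Rnf ∧ Rcs + Rnf = R.1 ∧
    (Rcs, R.2) ∈ p.region (N + P₁') K ∧ Rnf ≤ p.nfBound P₁' N K}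

/-- Rate-splitting region for fixed parameters, Transmitter 2 splitting its message. -/
def regionRS₂ (p : Params η) (P₂' N : ℝ) (K : Matrix (Fin 2) (Fin 2) ℝ) : Set (ℝ × ℝ) :=
  {R | ∃ Rcs Rnf : ℝ, 0 ≤ Rcs ∧ 0 ≤ Rnf ∧ Rcs + Rnf = R.2 ∧
    (R.1, Rcs) ∈ p.region (N + P₂') K ∧ Rnf ≤ p.nfBound P₂' N K}

end Params

/-- The rate-splitting region `R_{RS,1}(P₁', P₁'', P₂, N, K)`. -/
def rateRS₁ (P₁' P₁'' P₂ N : ℝ) (K : Matrix (Fin 2) (Fin 2) ℝ) : Set (ℝ × ℝ) :=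
  closure {R | ∃ (η : ℕ) (p : Params η), 0 < η ∧
    p.TraceConstraints P₁'' P₂ (N + P₁') K ∧ R ∈ p.regionRS₁ P₁' N K}

/-- The rate-splitting region `R_{RS,2}(P₁, P₂', P₂'', N, K)`. -/
def rateRS₂ (P₁ P₂' P₂'' N : ℝ) (K : Matrix (Fin 2) (Fin 2) ℝ) : Set (ℝ × ℝ) :=
  closure {R | ∃ (η : ℕ) (p : Params η), 0 < η ∧
    p.TraceConstraints P₁ P₂'' (N + P₂') K ∧ R ∈ p.regionRS₂ P₂' N K}

/-- The limit of a family of regions, indexed by feedback-noise covariance matrices, as the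
feedback-noise variances vanish irrespective of the correlation:
`cl (⋃_{σ² > 0} ⋂_{K ⪰ 0, tr K ≤ σ²} F(K))`. -/
def vanishingNoiseLimit (F : Matrix (Fin 2) (Fin 2) ℝ → Set (ℝ × ℝ)) : Set (ℝ × ℝ) :=
  closure (⋃ σsq ∈ Set.Ioi (0 : ℝ),
    ⋂ K ∈ {K : Matrix (Fin 2) (Fin 2) ℝ | K.PosSemidef ∧ K.trace ≤ σsq}, F K)

end AWGNMAC

end

/-!
*Outer bound.* The law of the channel outputs is compared with an autoregressive Gaussian law whose
one-step predictor ignores one or both of the messages. By a change of measure, a rate cannot exceed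
`½ log (S / N)`, where `S` is the mean-square error of the predictor; choosing the best predictor
linear in the inputs gives pentagons indexed by the average correlation of the two inputs, and these
are covered by Ozarow's rectangles with `ρ ≤ ρ*`.

*Achievability.* Without feedback noise, let each user repeatedly send its current linear estimation
error, with gains such that the correlation of the two errors alternates between `ρ` and `-ρ`. This
is possible exactly when `ρ` solves Ozarow's equation, and each channel use then multiplies the
precision for user `ν` by `1 + P_ν (1 - ρ²) / N`. For smaller `ρ` the power of the part of the
message sent without feedback is chosen, by an intermediate value argument, so that the remaining
powers satisfy Ozarow's equation with that part counted as noise. For a fixed scheme all bounds are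
continuous in the feedback-noise covariance `K`, and a positive semidefinite `K` of small trace is
small, so arbitrarily little slack in the rates absorbs the feedback noise.
-/

noncomputable section

namespace AWGNMAC

open MeasureTheory ProbabilityTheory
open scoped ENNReal NNReal

/-! ### Autoregressive Gaussian processes -/

section Pi

variable {n : ℕ} {X : Fin n → Type*} [∀ i, MeasurableSpace (X i)] (μ : ∀ i, Measure (X i))

lemma lintegral_fin_prod_eq_prod [∀ i, SigmaFinite (μ i)] {f : ∀ i, X i → ℝ≥0∞}
    (hf : ∀ i, Measurable (f i)) :
    ∫⁻ x, ∏ i, f i (x i) ∂Measure.pi μ = ∏ i, ∫⁻ x, f i x ∂μ i := by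
  induction n with
  | zero => simp
  | succ n ih =>
    have hsplit := (measurePreserving_piFinSuccAbove μ 0).symm
    have htail : Measurable fun y : ∀ i : Fin n, X i.succ => ∏ i, f i.succ (y i) := by fun_prop
    rw [← hsplit.lintegral_comp (by fun_prop), Fin.prod_univ_succ, ← ih _ fun i => hf i.succ]
    simp only [Fin.prod_univ_succ]
    exact lintegral_prod_mul (ν := Measure.pi fun i => μ i.succ) (hf 0).aemeasurable
      htail.aemeasurable

lemma pi_withDensity [∀ i, SigmaFinite (μ i)] {f : ∀ i, X i → ℝ≥0∞} (hf : ∀ i, Measurable (f i))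
    [∀ i, SigmaFinite ((μ i).withDensity (f i))] :
    Measure.pi (fun i => (μ i).withDensity (f i)) =
      (Measure.pi μ).withDensity fun x => ∏ i, f i (x i) := by
  classical
  refine Measure.pi_eq fun s hs => ?_
  have hindicator (x : ∀ i, X i) : (Set.univ.pi s).indicator (fun x => ∏ i, f i (x i)) x =
      ∏ i, (s i).indicator (f i) (x i) := by
    simp only [Set.indicator_apply, Finset.prod_ite_zero, Set.mem_univ_pi, Finset.mem_univ,
      true_imp_iff]
  rw [withDensity_apply _ (MeasurableSet.univ_pi hs),
    ← lintegral_indicator (MeasurableSet.univ_pi hs), lintegral_congr hindicator,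
    lintegral_fin_prod_eq_prod μ fun i => (hf i).indicator (hs i)]
  exact Finset.prod_congr rfl fun i _ => by
    rw [lintegral_indicator (hs i), withDensity_apply _ (hs i)]

end Pi

/-- The entries of `y` strictly before time `t`. -/
def past {n : ℕ} (t : Fin n) (y : Fin n → ℝ) : Fin (t : ℕ) → ℝ :=
  fun s => y ⟨s, s.2.trans t.2⟩

lemma measurable_past {n : ℕ} (t : Fin n) : Measurable (past t) :=
  measurable_pi_lambda _ fun _ => measurable_pi_apply _

/-- A one-step predictor: at time `t` it forms a guess from the `t` previous values. -/
abbrev Predictor (n : ℕ) : Type :=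
  (t : Fin n) → (Fin (t : ℕ) → ℝ) → ℝ

/-- The law of `n` IID centered Gaussian variables of variance `v`. -/
abbrev gaussianNoise (n : ℕ) (v : ℝ≥0) : Measure (Fin n → ℝ) :=
  Measure.pi fun _ => gaussianReal 0 v

/-- The prediction errors of `h` along `y`. -/
def residual {n : ℕ} (h : Predictor n) (y : Fin n → ℝ) (t : Fin n) : ℝ :=
  y t - h t (past t y)

/-- The autoregressive process with predictor `h` and prediction errors `z`. -/
def arProcess {n : ℕ} (h : Predictor n) (z : Fin n → ℝ) (t : Fin n) : ℝ :=
  (h t fun s : Fin (t : ℕ) => arProcess h z ⟨s, s.2.trans t.2⟩) + z t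
termination_by (t : ℕ)
decreasing_by exact s.2

/-- The law of the autoregressive process with predictor `h` driven by IID centered Gaussian noise
of variance `v`. -/
def arLaw {n : ℕ} (h : Predictor n) (v : ℝ≥0) : Measure (Fin n → ℝ) :=
  (gaussianNoise n v).map (arProcess h)

/-- The density of `arLaw h v` with respect to Lebesgue measure. -/
def arDensity {n : ℕ} (h : Predictor n) (v : ℝ≥0) (y : Fin n → ℝ) : ℝ :=
  ∏ t, gaussianPDFReal 0 v (residual h y t)

/-- The value predicted by `g` at time `t` along the process with predictor `h` and prediction
errors `z`. -/
def arPredict {n : ℕ} (h g : Predictor n) (t : Fin n) (z : Fin n → ℝ) : ℝ :=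
  g t (past t (arProcess h z))

section

variable {n : ℕ} {h k : Predictor n} {u v : ℝ≥0}

lemma arProcess_eq (h : Predictor n) (z : Fin n → ℝ) (t : Fin n) :
    arProcess h z t = arPredict h h t z + z t := by
  rw [arProcess]
  rfl

lemma eq_arProcess {z y : Fin n → ℝ} (hy : ∀ t, y t = h t (past t y) + z t) :
    y = arProcess h z := by
  ext ⟨j, hj⟩
  induction j using Nat.strong_induction_on with
  | _ j ih =>
    rw [hy, arProcess_eq]
    congr 2
    exact funext fun s => ih s s.2 _

lemma arProcess_residual (h : Predictor n) (y : Fin n → ℝ) : arProcess h (residual h y) = y :=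
  (eq_arProcess fun t => by rw [residual, add_sub_cancel]).symm

lemma residual_arProcess (h k : Predictor n) (z : Fin n → ℝ) (t : Fin n) :
    residual k (arProcess h z) t = arPredict h h t z - arPredict h k t z + z t := by
  rw [residual, arProcess_eq, add_sub_right_comm]
  rfl

lemma dependsOn_arProcess (h : Predictor n) (t : Fin n) :
    DependsOn (fun z => arProcess h z t) (Set.Iic t) := by
  obtain ⟨j, hj⟩ := t
  intro z z' hz
  beta_reduce
  induction j using Nat.strong_induction_on with
  | _ j ih =>
    rw [arProcess_eq, arProcess_eq, hz _ Set.self_mem_Iic]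
    exact congrArg (h _ · + _) <| funext fun s : Fin j => ih s s.2 _ fun r hr =>
      hz r (le_trans hr (Fin.mk_le_mk.2 s.2.le))

lemma dependsOn_arPredict (h g : Predictor n) (t : Fin n) :
    DependsOn (arPredict h g t) (Set.Iio t) := fun _ _ hz =>
  congrArg (g t) <| funext fun s => dependsOn_arProcess h _ fun r hr =>
    hz r (lt_of_le_of_lt hr (Fin.lt_def.2 s.2))

lemma measurable_residual (hh : ∀ t, Measurable (h t)) : Measurable (residual h) :=
  measurable_pi_lambda _ fun t => (measurable_pi_apply t).sub ((hh t).comp (measurable_past t))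

lemma measurable_arProcess (hh : ∀ t, Measurable (h t)) : Measurable (arProcess h) := by
  refine measurable_pi_lambda _ fun ⟨j, hj⟩ => ?_
  induction j using Nat.strong_induction_on with
  | _ j ih =>
    simp_rw [arProcess_eq]
    exact ((hh _).comp (measurable_pi_lambda _ fun s => ih s s.2 _)).add (measurable_pi_apply _)

lemma isProbabilityMeasure_arLaw (hh : ∀ t, Measurable (h t)) (v : ℝ≥0) :
    IsProbabilityMeasure (arLaw h v) :=
  Measure.isProbabilityMeasure_map (measurable_arProcess hh).aemeasurable

-- The residual map is lower triangular with unit diagonal, hence a composition of shears.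
lemma measurePreserving_residual {n : ℕ} {h : Predictor n} (hh : ∀ t, Measurable (h t)) :
    MeasurePreserving (residual h) volume volume := by
  induction n with
  | zero => exact (Subsingleton.elim id (residual h)) ▸ MeasurePreserving.id _
  | succ n ih =>
    have hsplit := volume_preserving_piFinSuccAbove (fun _ : Fin (n + 1) => ℝ) (Fin.last n)
    have hshear : MeasurePreserving (fun p : (Fin n → ℝ) × ℝ =>
        (residual (fun t : Fin n => h t.castSucc) p.1, p.2 - h (Fin.last n) p.1))
        (volume.prod volume) (volume.prod volume) :=
      (ih fun t => hh t.castSucc).skew_product (g := fun y x => x - h (Fin.last n) y)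
        (measurable_snd.sub ((hh _).comp measurable_fst))
        (ae_of_all _ fun y => (measurePreserving_sub_right volume (h (Fin.last n) y)).map_eq)
    have hcomp := (((hsplit.symm _).comp Measure.measurePreserving_swap).comp hshear).comp
      (Measure.measurePreserving_swap.comp hsplit)
    suffices hres : residual h = _ from hres ▸ hcomp
    ext y t
    refine Fin.lastCases ?_ (fun t => ?_) t <;>
    · simp only [residual, MeasurableEquiv.piFinSuccAbove, Fin.insertNthEquiv,
        Fin.insertNth_last', Fin.removeNth_last, Equiv.symm_mk, MeasurableEquiv.symm_mk,
        MeasurableEquiv.coe_mk, Equiv.coe_fn_mk, Function.comp_apply, Prod.swap_prod_mk,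
        Fin.snoc_last, Fin.snoc_castSucc]
      rfl

lemma measurable_arDensity (hh : ∀ t, Measurable (h t)) (v : ℝ≥0) :
    Measurable (arDensity h v) :=
  Finset.measurable_prod _ fun t _ =>
    (measurable_gaussianPDFReal 0 v).comp ((measurable_pi_apply t).comp (measurable_residual hh))

lemma arDensity_pos (h : Predictor n) (hv : v ≠ 0) (y : Fin n → ℝ) : 0 < arDensity h v y :=
  Finset.prod_pos fun _ _ => gaussianPDFReal_pos 0 v _ hv

lemma ofReal_arDensity (h : Predictor n) (v : ℝ≥0) (y : Fin n → ℝ) :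
    ENNReal.ofReal (arDensity h v y) = ∏ t, gaussianPDF 0 v (residual h y t) :=
  ENNReal.ofReal_prod_of_nonneg fun _ _ => gaussianPDFReal_nonneg _ _ _

lemma gaussianNoise_eq_withDensity (n : ℕ) (hv : v ≠ 0) :
    gaussianNoise n v = volume.withDensity fun y => ∏ t, gaussianPDF 0 v (y t) := by
  have hdensity := gaussianReal_of_var_ne_zero 0 hv
  have : SigmaFinite (volume.withDensity (gaussianPDF 0 v)) := hdensity ▸ inferInstance
  rw [gaussianNoise, hdensity]
  exact pi_withDensity _ fun _ => measurable_gaussianPDF 0 v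

lemma arLaw_eq_volume_withDensity (hh : ∀ t, Measurable (h t)) (hv : v ≠ 0) :
    arLaw h v = volume.withDensity fun y => ENNReal.ofReal (arDensity h v y) := by
  ext s hs
  have hpre : MeasurableSet (arProcess h ⁻¹' s) := measurable_arProcess hh hs
  have hdensity : Measurable fun y : Fin n → ℝ => ∏ t, gaussianPDF 0 v (y t) := by fun_prop
  rw [arLaw, Measure.map_apply (measurable_arProcess hh) hs, gaussianNoise_eq_withDensity n hv,
    withDensity_apply _ hpre, withDensity_apply _ hs,
    ← (measurePreserving_residual hh).setLIntegral_comp_preimage hpre hdensity]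
  simp_rw [ofReal_arDensity, ← Set.preimage_comp, Function.comp_def, arProcess_residual,
    Set.preimage_id']

lemma arLaw_eq_withDensity (hh : ∀ t, Measurable (h t)) (hk : ∀ t, Measurable (k t))
    (hu : u ≠ 0) (hv : v ≠ 0) :
    arLaw k v = (arLaw h u).withDensity fun y =>
      ENNReal.ofReal (arDensity k v y / arDensity h u y) := by
  have hratio : Measurable fun y => arDensity k v y / arDensity h u y :=
    (measurable_arDensity hk v).div (measurable_arDensity hh u)
  rw [arLaw_eq_volume_withDensity hk hv, arLaw_eq_volume_withDensity hh hu,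
    ← withDensity_mul _ (measurable_arDensity hh u).ennreal_ofReal hratio.ennreal_ofReal]
  congr with y
  rw [Pi.mul_apply, ← ENNReal.ofReal_mul (arDensity_pos h hu y).le,
    mul_div_cancel₀ _ (arDensity_pos h hu y).ne']

end

/-! ### Change of measure -/

lemma integral_add_integral_log_le {α : Type*} [MeasurableSpace α] {μ : Measure α}
    [IsProbabilityMeasure μ] {r f : α → ℝ} (hr : Measurable r) (hpos : ∀ x, 0 < r x)
    (hlog : Integrable (fun x => Real.log (r x)) μ) (hf : Integrable f μ)
    (hexp : Integrable (fun x => Real.exp (f x)) (μ.withDensity fun x => ENNReal.ofReal (r x))) :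
    ∫ x, f x ∂μ + ∫ x, Real.log (r x) ∂μ ≤
      ∫ x, Real.exp (f x) ∂(μ.withDensity fun x => ENNReal.ofReal (r x)) - 1 := by
  have htoReal (x : α) : (ENNReal.ofReal (r x)).toReal = r x := ENNReal.toReal_ofReal (hpos x).le
  have hfinite : ∀ᵐ x ∂μ, ENNReal.ofReal (r x) < ∞ := ae_of_all _ fun _ => ENNReal.ofReal_lt_top
  rw [integrable_withDensity_iff_integrable_smul' hr.ennreal_ofReal hfinite] at hexp
  rw [integral_withDensity_eq_integral_toReal_smul hr.ennreal_ofReal hfinite,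
    ← integral_add hf hlog]
  simp only [htoReal, smul_eq_mul] at hexp ⊢
  calc ∫ x, f x + Real.log (r x) ∂μ
    _ ≤ ∫ x, r x * Real.exp (f x) - 1 ∂μ :=
        integral_mono (hf.add hlog) (hexp.sub (integrable_const 1)) fun x => by
          have := Real.log_le_sub_one_of_pos (mul_pos (hpos x) (Real.exp_pos (f x)))
          rwa [Real.log_mul (hpos x).ne' (Real.exp_ne_zero _), Real.log_exp, add_comm] at this
    _ = ∫ x, r x * Real.exp (f x) ∂μ - 1 := by
        rw [integral_sub hexp (integrable_const 1), integral_const, probReal_univ, one_smul]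

lemma log_mul_measureReal_sub_le {α : Type*} [MeasurableSpace α] {μ : Measure α}
    [IsProbabilityMeasure μ] {r : α → ℝ} (hr : Measurable r) (hpos : ∀ x, 0 < r x)
    (hlog : Integrable (fun x => Real.log (r x)) μ)
    [IsProbabilityMeasure (μ.withDensity fun x => ENNReal.ofReal (r x))]
    {D : Set α} (hD : MeasurableSet D) {L : ℝ} (hL : 0 < L) :
    Real.log L * μ.real D - L * (μ.withDensity fun x => ENNReal.ofReal (r x)).real D ≤
      -∫ x, Real.log (r x) ∂μ := by
  set Q := μ.withDensity fun x => ENNReal.ofReal (r x)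
  have hexp : (fun x => Real.exp (D.indicator (fun _ => Real.log L) x)) =
      fun x => 1 + D.indicator (fun _ => L - 1) x := by
    ext x
    by_cases hx : x ∈ D <;> simp [hx, Real.exp_log hL]
  have hind : Integrable (D.indicator fun _ => L - 1) Q := (integrable_const _).indicator hD
  have h := integral_add_integral_log_le hr hpos hlog (f := D.indicator fun _ => Real.log L)
    ((integrable_const _).indicator hD) (hexp ▸ (integrable_const 1).add hind)
  rw [hexp, integral_add (integrable_const 1) hind, integral_indicator_const _ hD,
    integral_indicator_const _ hD, integral_const, probReal_univ] at h
  simp only [smul_eq_mul] at h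
  have := measureReal_nonneg (μ := Q) (s := D)
  linarith

lemma integral_mul_eval_eq_zero {ι : Type*} [Fintype ι] {μ : ι → Measure ℝ}
    [∀ i, SigmaFinite (μ i)] {t : ι} (hμ : MeasurePreserving Neg.neg (μ t) (μ t))
    {f : (ι → ℝ) → ℝ} (hf : DependsOn f {t}ᶜ) :
    ∫ z, f z * z t ∂Measure.pi μ = 0 := by
  classical
  let flip : (ι → ℝ) ≃ᵐ (ι → ℝ) :=
    MeasurableEquiv.piCongrRight fun i => if i = t then .neg ℝ else .refl ℝ
  have hflip (z : ι → ℝ) (i : ι) :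
      flip z i = (if i = t then .neg ℝ else .refl ℝ : ℝ ≃ᵐ ℝ) (z i) := rfl
  have hflip_self (z : ι → ℝ) : flip z t = -z t := by simp [hflip]
  have hflip_ne (z : ι → ℝ) {i : ι} (hi : i ≠ t) : flip z i = z i := by simp [hflip, hi]
  have hpres : MeasurePreserving flip (Measure.pi μ) (Measure.pi μ) := by
    refine measurePreserving_pi _ _ fun i => ?_
    obtain rfl | hi := eq_or_ne i t
    · simpa using hμ
    · simpa [hi] using MeasurePreserving.id _
  have hodd (z : ι → ℝ) : f (flip z) * flip z t = -(f z * z t) := by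
    rw [hf fun i hi => hflip_ne z hi, hflip_self, mul_neg]
  have h := hpres.integral_comp flip.measurableEmbedding fun z => f z * z t
  simp_rw [hodd, integral_neg] at h
  linarith

lemma measurePreserving_neg_gaussianReal (v : ℝ≥0) :
    MeasurePreserving Neg.neg (gaussianReal 0 v) (gaussianReal 0 v) :=
  ⟨measurable_neg, by simpa using gaussianReal_map_neg (μ := 0) (v := v)⟩

lemma memLp_eval_gaussianNoise {n : ℕ} (u : ℝ≥0) (t : Fin n) :
    MemLp (fun z : Fin n → ℝ => z t) 2 (gaussianNoise n u) :=
  (memLp_id_gaussianReal' 2 (by simp)).comp_measurePreserving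
    (measurePreserving_eval (fun _ : Fin n => gaussianReal 0 u) t)

lemma integral_eval_sq_gaussianNoise {n : ℕ} (u : ℝ≥0) (t : Fin n) :
    ∫ z, z t ^ 2 ∂gaussianNoise n u = u := by
  have hmarginal := measurePreserving_eval (fun _ : Fin n => gaussianReal 0 u) t
  calc ∫ z, z t ^ 2 ∂gaussianNoise n u
    _ = ∫ x, x ^ 2 ∂gaussianReal 0 u := by
        rw [← hmarginal.map_eq, integral_map hmarginal.measurable.aemeasurable (by fun_prop)]
    _ = u := by
        have h := variance_fun_id_gaussianReal (μ := 0) (v := u)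
        rw [variance_eq_integral (by fun_prop)] at h
        simpa using h

lemma log_gaussianPDFReal {v : ℝ≥0} (hv : v ≠ 0) (x : ℝ) :
    Real.log (gaussianPDFReal 0 v x) =
      -(1 / 2 * Real.log (2 * Real.pi * v)) - x ^ 2 / (2 * v) := by
  have hs : 0 < 2 * Real.pi * (v : ℝ) := mul_pos Real.two_pi_pos (by positivity)
  rw [gaussianPDFReal, Real.log_mul (inv_ne_zero (Real.sqrt_pos.2 hs).ne') (Real.exp_ne_zero _),
    Real.log_exp, Real.log_inv,
    Real.log_sqrt hs.le]
  ring

section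

variable {n : ℕ} {h k : Predictor n} {u v : ℝ≥0}

lemma log_gaussianPDFReal_sub (hu : u ≠ 0) (hv : v ≠ 0) (d z : ℝ) :
    Real.log (gaussianPDFReal 0 v (d + z)) - Real.log (gaussianPDFReal 0 u z) =
      -(1 / 2 * Real.log (v / u)) + (-(1 / (2 * v)) * d ^ 2 + (-(1 / v) * (d * z) +
        (1 / (2 * u) - 1 / (2 * v)) * z ^ 2)) := by
  have hu' : (u : ℝ) ≠ 0 := by exact_mod_cast hu
  have hv' : (v : ℝ) ≠ 0 := by exact_mod_cast hv
  have hpi : (2 * Real.pi) ≠ 0 := by positivity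
  rw [log_gaussianPDFReal hv, log_gaussianPDFReal hu, Real.log_div hv' hu',
    Real.log_mul hpi hv', Real.log_mul hpi hu']
  field

lemma log_arDensity_div (hu : u ≠ 0) (hv : v ≠ 0) (z : Fin n → ℝ) :
    Real.log (arDensity k v (arProcess h z) / arDensity h u (arProcess h z)) =
      ∑ t, (Real.log (gaussianPDFReal 0 v (arPredict h h t z - arPredict h k t z + z t)) -
        Real.log (gaussianPDFReal 0 u (z t))) := by
  rw [Real.log_div (arDensity_pos k hv _).ne' (arDensity_pos h hu _).ne', arDensity, arDensity,
    Real.log_prod fun t _ => (gaussianPDFReal_pos 0 v _ hv).ne',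
    Real.log_prod fun t _ => (gaussianPDFReal_pos 0 u _ hu).ne', ← Finset.sum_sub_distrib]
  simp only [residual_arProcess, sub_self, zero_add]

section

variable {μ : Measure (Fin n → ℝ)} [IsProbabilityMeasure μ] {d e : (Fin n → ℝ) → ℝ}

lemma integrable_log_gaussianPDFReal_sub (hu : u ≠ 0) (hv : v ≠ 0)
    (hd : MemLp d 2 μ) (he : MemLp e 2 μ) :
    Integrable (fun z => Real.log (gaussianPDFReal 0 v (d z + e z)) -
      Real.log (gaussianPDFReal 0 u (e z))) μ := by
  simp_rw [log_gaussianPDFReal_sub hu hv]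
  exact (integrable_const _).add ((hd.integrable_sq.const_mul _).add
    (((hd.integrable_mul he).const_mul _).add (he.integrable_sq.const_mul _)))

lemma integral_log_gaussianPDFReal_sub (hu : u ≠ 0) (hv : v ≠ 0)
    (hd : MemLp d 2 μ) (he : MemLp e 2 μ) (hcov : ∫ z, d z * e z ∂μ = 0)
    (hvar : ∫ z, e z ^ 2 ∂μ = u) :
    ∫ z, (Real.log (gaussianPDFReal 0 v (d z + e z)) - Real.log (gaussianPDFReal 0 u (e z))) ∂μ =
      -(1 / 2 * Real.log (v / u) - 1 / 2 + (u + ∫ z, d z ^ 2 ∂μ) / (2 * v)) := by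
  have hu' : (u : ℝ) ≠ 0 := by exact_mod_cast hu
  have hd2 := hd.integrable_sq.const_mul (-(1 / (2 * v : ℝ)))
  have hde := (hd.integrable_mul he).const_mul (-(1 / v : ℝ))
  have he2 := he.integrable_sq.const_mul (1 / (2 * u) - 1 / (2 * v : ℝ))
  simp only [Pi.mul_apply] at hde
  simp_rw [log_gaussianPDFReal_sub hu hv]
  rw [integral_add (integrable_const _) (hd2.fun_add (hde.fun_add he2)),
    integral_add hd2 (hde.fun_add he2),
    integral_add hde he2]
  simp only [integral_const_mul, integral_const, probReal_univ, one_smul, hcov, hvar]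
  field

end

lemma log_mul_arLaw_sub_le (hh : ∀ t, Measurable (h t)) (hk : ∀ t, Measurable (k t))
    (hu : u ≠ 0) (hv : v ≠ 0)
    (hd : ∀ t, MemLp (fun z => arPredict h h t z - arPredict h k t z) 2 (gaussianNoise n u))
    {D : Set (Fin n → ℝ)} (hD : MeasurableSet D) {L : ℝ} (hL : 0 < L) :
    Real.log L * (arLaw h u).real D - L * (arLaw k v).real D ≤
      ∑ t, (1 / 2 * Real.log (v / u) - 1 / 2 +
        (u + ∫ z, (arPredict h h t z - arPredict h k t z) ^ 2 ∂gaussianNoise n u) / (2 * v)) := by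
  have hprocess := measurable_arProcess hh
  have hratio : Measurable fun y => arDensity k v y / arDensity h u y :=
    (measurable_arDensity hk v).div (measurable_arDensity hh u)
  have hinnov (t : Fin n) := memLp_eval_gaussianNoise u t
  have huncorr (t : Fin n) :
      ∫ z, (arPredict h h t z - arPredict h k t z) * z t ∂gaussianNoise n u = 0 :=
    integral_mul_eval_eq_zero (μ := fun _ => gaussianReal 0 u)
      (measurePreserving_neg_gaussianReal u)
      ((dependsOn_arPredict h (fun t y => h t y - k t y) t).mono fun _ hs => ne_of_lt hs)
  have hint : Integrable (fun y => Real.log (arDensity k v y / arDensity h u y)) (arLaw h u) := by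
    rw [arLaw, integrable_map_measure hratio.log.aestronglyMeasurable hprocess.aemeasurable]
    simp only [Function.comp_def, log_arDensity_div hu hv]
    exact integrable_finsetSum _ fun t _ =>
      integrable_log_gaussianPDFReal_sub hu hv (hd t) (hinnov t)
  have := isProbabilityMeasure_arLaw hh u
  have := isProbabilityMeasure_arLaw hk v
  rw [arLaw_eq_withDensity hh hk hu hv] at this ⊢
  refine (log_mul_measureReal_sub_le hratio
    (fun y => div_pos (arDensity_pos k hv y) (arDensity_pos h hu y)) hint hD hL).trans_eq ?_
  rw [arLaw, integral_map hprocess.aemeasurable hratio.log.aestronglyMeasurable]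
  simp only [log_arDensity_div hu hv]
  rw [integral_finsetSum _ fun t _ =>
    integrable_log_gaussianPDFReal_sub hu hv (hd t) (hinnov t), ← Finset.sum_neg_distrib]
  exact Finset.sum_congr rfl fun t _ => by
    rw [integral_log_gaussianPDFReal_sub hu hv (hd t) (hinnov t) (huncorr t)
      (integral_eval_sq_gaussianNoise u t), neg_neg]

end

/-! ### Codes with perfect feedback -/

lemma pi_dirac {ι : Type*} [Fintype ι] {X : ι → Type*} [∀ i, MeasurableSpace (X i)]
    (x : ∀ i, X i) :
    Measure.pi (fun i => Measure.dirac (x i)) = Measure.dirac x := by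
  classical
  refine Measure.pi_eq fun s hs => ?_
  simp only [Measure.dirac_apply' _ (MeasurableSet.univ_pi hs), Measure.dirac_apply' _ (hs _),
    Set.indicator_apply, Pi.one_apply, Finset.prod_ite_zero, Set.mem_univ_pi, Finset.mem_univ,
    true_imp_iff, Finset.prod_const_one]

lemma noiseLaw_zero (n : ℕ) (N : ℝ) :
    noiseLaw n N 0 = (gaussianNoise n N.toNNReal).map fun z => (z, 0) := by
  have hW : multivariateGaussian (0 : EuclideanSpace ℝ (Fin 2)) 0 = Measure.dirac 0 := by
    simp [multivariateGaussian]
  rw [noiseLaw, hW, pi_dirac, Measure.prod_dirac]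
  rfl

lemma measurableEmbedding_prodMk_zero (n : ℕ) : MeasurableEmbedding
    fun z : Fin n → ℝ => (z, (0 : Fin n → EuclideanSpace ℝ (Fin 2))) :=
  measurableEmbedding_prod_mk_right 0

lemma sum_fin_two_of_ne {α : Type*} [AddCommMonoid α] {ν ν' : Fin 2} (h : ν ≠ ν')
    (f : Fin 2 → α) : ∑ μ, f μ = f ν + f ν' :=
  Fintype.sum_eq_add ν ν' h fun μ hμ => by omega

/-- The capacity of the Gaussian channel with signal-to-noise ratio `snr`. -/
def awgnCap (snr : ℝ) : ℝ :=
  1 / 2 * Real.log (1 + snr)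

lemma awgnCap_nonneg {snr : ℝ} (h : 0 ≤ snr) : 0 ≤ awgnCap snr :=
  mul_nonneg (by norm_num) (Real.log_nonneg (by linarith))

lemma awgnCap_pos {snr : ℝ} (h : 0 < snr) : 0 < awgnCap snr :=
  mul_pos (by norm_num) (Real.log_pos (by linarith))

lemma awgnCap_le_awgnCap {snr snr' : ℝ} (h : 0 ≤ snr) (hle : snr ≤ snr') :
    awgnCap snr ≤ awgnCap snr' :=
  mul_le_mul_of_nonneg_left (Real.log_le_log (by linarith) (by linarith)) (by norm_num)

namespace FeedbackCode

variable {n : ℕ} {M : Fin 2 → ℕ} (c : FeedbackCode n M)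

lemma card_messages : (Fintype.card ((ν : Fin 2) → Fin (M ν)) : ℝ) = M 0 * M 1 := by
  simp [Fin.prod_univ_two]

include c in
lemma messages_pos : (0 : ℝ) < M 0 * M 1 :=
  mul_pos (Nat.cast_pos.2 (c.card_pos 0)) (Nat.cast_pos.2 (c.card_pos 1))

/-- The predictor of the channel output from its past that adds the input of user `ν`, given the
message `m ν`, with weight `γ ν`. -/
def predictor (γ : Fin 2 → ℝ) (m : (ν : Fin 2) → Fin (M ν)) : Predictor n :=
  fun t y => ∑ ν, γ ν * c.enc ν t (m ν) y

lemma measurable_predictor (γ : Fin 2 → ℝ) (m : (ν : Fin 2) → Fin (M ν)) (t : Fin n) :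
    Measurable (c.predictor γ m t) :=
  Finset.measurable_sum _ fun ν _ => (c.measurable_enc ν t (m ν)).const_mul _

lemma output_zero (m : (ν : Fin 2) → Fin (M ν)) (z : Fin n → ℝ) :
    c.output m z 0 = arProcess (c.predictor 1 m) z := by
  refine eq_arProcess fun t => ?_
  rw [output]
  simp only [predictor, Pi.zero_apply, Pi.one_apply, PiLp.zero_apply, add_zero, one_mul]
  rfl

lemma input_zero (m : (ν : Fin 2) → Fin (M ν)) (z : Fin n → ℝ) (ν : Fin 2) (t : Fin n) :
    c.input m z 0 ν t = arPredict (c.predictor 1 m) (fun t => c.enc ν t (m ν)) t z := by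
  rw [input, output_zero]
  simp only [Pi.zero_apply, PiLp.zero_apply, add_zero, arPredict]
  rfl

lemma arPredict_sub_arPredict (β : Fin 2 → ℝ) (m : (ν : Fin 2) → Fin (M ν)) (t : Fin n)
    (z : Fin n → ℝ) :
    arPredict (c.predictor 1 m) (c.predictor 1 m) t z -
      arPredict (c.predictor 1 m) (c.predictor (1 - β) m) t z = ∑ ν, β ν * c.input m z 0 ν t := by
  simp only [input_zero, arPredict, predictor, ← Finset.sum_sub_distrib, ← sub_mul, Pi.sub_apply,
    sub_sub_cancel]

lemma measurableSet_dec (m : (ν : Fin 2) → Fin (M ν)) : MeasurableSet {y | c.dec y = m} :=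
  c.measurable_dec (measurableSet_singleton m)

lemma measureReal_error (N : ℝ) (m : (ν : Fin 2) → Fin (M ν)) :
    (noiseLaw n N 0).real {ω | c.dec (c.output m ω.1 ω.2) ≠ m} =
      1 - (arLaw (c.predictor 1 m) N.toNNReal).real {y | c.dec y = m} := by
  have hp := c.measurable_predictor 1 m
  have hD := c.measurableSet_dec m
  have := isProbabilityMeasure_arLaw hp N.toNNReal
  rw [← probReal_compl_eq_one_sub hD, arLaw, noiseLaw_zero, measureReal_def, measureReal_def,
    Measure.map_apply (measurable_arProcess hp) hD.compl,
    (measurableEmbedding_prodMk_zero n).map_apply]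
  simp only [Set.preimage_ofPred_eq, output_zero]
  rfl

lemma one_sub_errorProb (N : ℝ) :
    1 - c.errorProb N 0 = (1 / ((M 0 : ℝ) * M 1)) * ∑ m : (ν : Fin 2) → Fin (M ν),
      (arLaw (c.predictor 1 m) N.toNNReal).real {y | c.dec y = m} := by
  simp only [errorProb, measureReal_error, Finset.sum_sub_distrib, Finset.sum_const,
    Finset.card_univ, nsmul_eq_mul, card_messages, mul_sub, mul_one,
    one_div_mul_cancel c.messages_pos.ne', sub_sub_cancel]

lemma sum_measureReal_dec_le_one (Q : Measure (Fin n → ℝ)) [IsProbabilityMeasure Q]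
    (s : Finset ((ν : Fin 2) → Fin (M ν))) : ∑ m ∈ s, Q.real {y | c.dec y = m} ≤ 1 :=
  (sum_measureReal_preimage_singleton (μ := Q) s (f := c.dec)
    fun m _ => c.measurableSet_dec m).le.trans measureReal_le_one

lemma sum_measureReal_dec_predictor_zero_le (v : ℝ≥0) :
    ∑ m : (ν : Fin 2) → Fin (M ν), (arLaw (c.predictor 0 m) v).real {y | c.dec y = m} ≤ 1 := by
  have hp (m : (ν : Fin 2) → Fin (M ν)) : c.predictor 0 m = fun _ _ => 0 := by
    simp [predictor, funext_iff]
  have := isProbabilityMeasure_arLaw (n := n) (h := fun _ _ => 0) (fun _ => measurable_const) v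
  simp_rw [hp]
  exact c.sum_measureReal_dec_le_one _ _

lemma sum_measureReal_dec_predictor_le {γ : Fin 2 → ℝ} {ν ν' : Fin 2} (hν : ν ≠ ν')
    (hγ : γ ν = 0) (v : ℝ≥0) :
    ∑ m : (ν : Fin 2) → Fin (M ν), (arLaw (c.predictor γ m) v).real {y | c.dec y = m} ≤ M ν' := by
  have hfiber (j : Fin (M ν')) : ∑ m : (ν : Fin 2) → Fin (M ν) with m ν' = j,
      (arLaw (c.predictor γ m) v).real {y | c.dec y = m} ≤ 1 := by
    let h : Predictor n := fun t y => γ ν' * c.enc ν' t j y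
    have := isProbabilityMeasure_arLaw (h := h) (fun t => (c.measurable_enc ν' t j).const_mul _) v
    refine (Finset.sum_congr rfl fun m hm => ?_).trans_le
      (c.sum_measureReal_dec_le_one (arLaw h v) {m | m ν' = j})
    have hp : c.predictor γ m = h := by
      obtain rfl := (Finset.mem_filter.1 hm).2
      ext t y
      rw [predictor, sum_fin_two_of_ne hν, hγ, zero_mul, zero_add]
    rw [hp]
  rw [← Finset.sum_fiberwise Finset.univ fun m : (ν : Fin 2) → Fin (M ν) => m ν']
  exact (Finset.sum_le_sum fun j _ => hfiber j).trans (by simp)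

/-- The correlation matrix of the two channel inputs with perfect feedback, averaged over the
messages and over time. -/
def inputCorr (N : ℝ) : Matrix (Fin 2) (Fin 2) ℝ :=
  Matrix.of fun ν ν' => (1 / (n : ℝ)) * ∑ t, (1 / ((M 0 : ℝ) * M 1)) *
    ∑ m, ∫ z, c.input m z 0 ν t * c.input m z 0 ν' t ∂gaussianNoise n N.toNNReal

lemma inputCorr_comm (N : ℝ) (ν ν' : Fin 2) : c.inputCorr N ν ν' = c.inputCorr N ν' ν := by
  simp only [inputCorr, Matrix.of_apply, mul_comm (c.input _ _ _ ν _)]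

lemma PowerConstraint.memLp {c : FeedbackCode n M} {N P : ℝ} {ν : Fin 2}
    (h : c.PowerConstraint N 0 ν P) (m : (ν : Fin 2) → Fin (M ν)) (t : Fin n) :
    MemLp (fun z => c.input m z 0 ν t) 2 (gaussianNoise n N.toNNReal) := by
  have hmem := h.1 m t
  rw [noiseLaw_zero] at hmem
  exact (memLp_map_measure_iff hmem.aestronglyMeasurable
    measurable_prodMk_right.aemeasurable).1 hmem

lemma PowerConstraint.inputCorr_le {c : FeedbackCode n M} {N P : ℝ} {ν : Fin 2}
    (h : c.PowerConstraint N 0 ν P) : c.inputCorr N ν ν ≤ P := by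
  have hle := h.2
  simp_rw [noiseLaw_zero, (measurableEmbedding_prodMk_zero n).integral_map, sq] at hle
  exact hle

section

variable {c} {N : ℝ}
  (hL2 : ∀ m ν t, MemLp (fun z => c.input m z 0 ν t) 2 (gaussianNoise n N.toNNReal))
include hL2

lemma integral_sq_sum_input (β : Fin 2 → ℝ) (m : (ν : Fin 2) → Fin (M ν)) (t : Fin n) :
    ∫ z, (∑ ν, β ν * c.input m z 0 ν t) ^ 2 ∂gaussianNoise n N.toNNReal =
      ∑ ν, ∑ ν', β ν * β ν' *
        ∫ z, c.input m z 0 ν t * c.input m z 0 ν' t ∂gaussianNoise n N.toNNReal := by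
  have hint (ν ν' : Fin 2) : Integrable (fun z => c.input m z 0 ν t * c.input m z 0 ν' t)
      (gaussianNoise n N.toNNReal) := (hL2 m ν t).integrable_mul (hL2 m ν' t)
  simp_rw [sq, Finset.sum_mul_sum, mul_mul_mul_comm (β _)]
  rw [integral_finsetSum _ fun ν _ => integrable_finsetSum _ fun ν' _ => (hint ν ν').const_mul _]
  refine Finset.sum_congr rfl fun ν _ => ?_
  simp_rw [integral_finsetSum _ fun ν' _ => (hint ν ν').const_mul _, integral_const_mul]

lemma sum_integral_sq_sum_input (β : Fin 2 → ℝ) :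
    ∑ m, ∑ t, ∫ z, (∑ ν, β ν * c.input m z 0 ν t) ^ 2 ∂gaussianNoise n N.toNNReal =
      n * (M 0 * M 1) * (β ⬝ᵥ c.inputCorr N *ᵥ β) := by
  have hM := c.messages_pos.ne'
  rcases Nat.eq_zero_or_pos n with rfl | hn
  · simp
  simp only [integral_sq_sum_input hL2]
  simp only [inputCorr, dotProduct, Matrix.mulVec, Matrix.of_apply,
    Fin.sum_univ_two, Finset.sum_add_distrib, ← Finset.mul_sum]
  simp only [Finset.sum_comm (s := (Finset.univ : Finset (Fin n)))]
  generalize (M 0 : ℝ) * M 1 = K at hM ⊢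
  field_simp
  ring

lemma dotProduct_inputCorr_nonneg (β : Fin 2 → ℝ) : 0 ≤ β ⬝ᵥ c.inputCorr N *ᵥ β := by
  rcases Nat.eq_zero_or_pos n with rfl | hn
  · simp [inputCorr, dotProduct, Matrix.mulVec]
  · have hn' : (0 : ℝ) < n * (M 0 * M 1) := mul_pos (Nat.cast_pos.2 hn) c.messages_pos
    refine nonneg_of_mul_nonneg_right ?_ hn'
    rw [← sum_integral_sq_sum_input hL2]
    exact Finset.sum_nonneg fun m _ => Finset.sum_nonneg fun t _ =>
      integral_nonneg fun z => sq_nonneg _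

end

end FeedbackCode

/-! ### The outer bound on the perfect-feedback capacity region -/

lemma continuous_awgnCap_comp {α : Type*} [TopologicalSpace α] {f : α → ℝ} (hf : Continuous f)
    (hnonneg : ∀ x, 0 ≤ f x) : Continuous fun x => awgnCap (f x) :=
  ((hf.const_add 1).log fun x => (by linarith [hnonneg x] : 0 < 1 + f x).ne').const_mul _

lemma dotProduct_mulVec_fin_two_of_ne {A : Matrix (Fin 2) (Fin 2) ℝ} {ν ν' : Fin 2} (hν : ν ≠ ν')
    (hA : A ν ν' = A ν' ν) (β : Fin 2 → ℝ) :
    β ⬝ᵥ A *ᵥ β = β ν ^ 2 * A ν ν + 2 * β ν * β ν' * A ν ν' + β ν' ^ 2 * A ν' ν' := by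
  simp only [dotProduct, Matrix.mulVec, sum_fin_two_of_ne hν, ← hA]
  ring

lemma exists_dotProduct_mulVec_le {A : Matrix (Fin 2) (Fin 2) ℝ} {ν ν' : Fin 2} (hν : ν ≠ ν')
    (hA : A ν ν' = A ν' ν) {P P' : ℝ} (hP' : 0 < P') (hle : A ν ν ≤ P) (hle' : A ν' ν' ≤ P') :
    ∃ β : Fin 2 → ℝ, β ν = 1 ∧ β ⬝ᵥ A *ᵥ β ≤ P - A ν ν' ^ 2 / P' := by
  -- the residual of the linear regression of user `ν` on user `ν'`
  let β : Fin 2 → ℝ := fun μ => if μ = ν then 1 else -(A ν ν' / P')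
  have hβ : β ν = 1 := if_pos rfl
  have hβ' : β ν' = -(A ν ν' / P') := if_neg hν.symm
  refine ⟨β, hβ, ?_⟩
  calc β ⬝ᵥ A *ᵥ β
    _ = A ν ν - 2 * (A ν ν' ^ 2 / P') + (A ν ν' / P') ^ 2 * A ν' ν' := by
      rw [dotProduct_mulVec_fin_two_of_ne hν hA, hβ, hβ']
      ring
    _ ≤ P - 2 * (A ν ν' ^ 2 / P') + (A ν ν' / P') ^ 2 * P' := by gcongr
    _ = P - A ν ν' ^ 2 / P' := by
      field_simp
      ring

lemma mul_one_sub_sq_div_sqrt {P P' : ℝ} (hP : 0 < P) (hP' : 0 < P') (x : ℝ) :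
    P * (1 - (|x| / √(P * P')) ^ 2) = P - x ^ 2 / P' := by
  rw [div_pow, sq_abs, Real.sq_sqrt (mul_pos hP hP').le]
  field_simp

lemma exists_correlation {A : Matrix (Fin 2) (Fin 2) ℝ} (hA : A 0 1 = A 1 0)
    (hnonneg : ∀ β, 0 ≤ β ⬝ᵥ A *ᵥ β) {P₁ P₂ : ℝ} (hP₁ : 0 < P₁) (hP₂ : 0 < P₂)
    (h₁ : A 0 0 ≤ P₁) (h₂ : A 1 1 ≤ P₂) :
    ∃ ρ ∈ Set.Icc (0 : ℝ) 1, (∃ β : Fin 2 → ℝ, β 0 = 1 ∧ β ⬝ᵥ A *ᵥ β ≤ P₁ * (1 - ρ ^ 2)) ∧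
      (∃ β : Fin 2 → ℝ, β 1 = 1 ∧ β ⬝ᵥ A *ᵥ β ≤ P₂ * (1 - ρ ^ 2)) ∧
      1 ⬝ᵥ A *ᵥ 1 ≤ P₁ + P₂ + 2 * √(P₁ * P₂) * ρ := by
  have hs : 0 < √(P₁ * P₂) := Real.sqrt_pos.2 (mul_pos hP₁ hP₂)
  obtain ⟨β₁, hβ₁, hle₁⟩ := exists_dotProduct_mulVec_le (by decide) hA hP₂ h₁ h₂
  obtain ⟨β₂, hβ₂, hle₂⟩ := exists_dotProduct_mulVec_le (by decide) hA.symm hP₁ h₂ h₁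
  rw [← mul_one_sub_sq_div_sqrt hP₁ hP₂] at hle₁
  rw [← mul_one_sub_sq_div_sqrt hP₂ hP₁, ← hA, mul_comm P₂ P₁] at hle₂
  refine ⟨|A 0 1| / √(P₁ * P₂), ⟨by positivity, ?_⟩, ⟨β₁, hβ₁, hle₁⟩, ⟨β₂, hβ₂, hle₂⟩, ?_⟩
  · have hsq := nonneg_of_mul_nonneg_right ((hnonneg β₁).trans hle₁) hP₁
    exact (sq_le_one_iff₀ (by positivity)).1 (sub_nonneg.1 hsq)
  · rw [dotProduct_mulVec_fin_two_of_ne (by decide) hA, mul_assoc 2 √_, mul_div_cancel₀ _ hs.ne']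
    simp only [Pi.one_apply]
    linarith [le_abs_self (A 0 1)]

namespace FeedbackCode

variable {n : ℕ} {M : Fin 2 → ℕ} {c : FeedbackCode n M} {N : ℝ}

section

variable (hN : 0 < N)
  (hL2 : ∀ m ν t, MemLp (fun z => c.input m z 0 ν t) 2 (gaussianNoise n N.toNNReal))
include hN hL2

lemma log_mul_measureReal_dec_sub_le (β : Fin 2 → ℝ) (m : (ν : Fin 2) → Fin (M ν)) {S L : ℝ}
    (hS : 0 < S) (hL : 0 < L) :
    Real.log L * (arLaw (c.predictor 1 m) N.toNNReal).real {y | c.dec y = m} -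
        L * (arLaw (c.predictor (1 - β) m) S.toNNReal).real {y | c.dec y = m} ≤
      ∑ t, (1 / 2 * Real.log (S / N) - 1 / 2 +
        (N + ∫ z, (∑ ν, β ν * c.input m z 0 ν t) ^ 2 ∂gaussianNoise n N.toNNReal) / (2 * S)) := by
  have hle := log_mul_arLaw_sub_le (c.measurable_predictor 1 m) (c.measurable_predictor (1 - β) m)
    (Real.toNNReal_pos.2 hN).ne' (Real.toNNReal_pos.2 hS).ne'
    (fun t => by
      simp_rw [arPredict_sub_arPredict]
      exact memLp_finsetSum _ fun ν _ => (hL2 m ν t).const_mul _)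
    (c.measurableSet_dec m) hL
  simpa only [arPredict_sub_arPredict, Real.coe_toNNReal _ hN.le, Real.coe_toNNReal _ hS.le]
    using hle

lemma log_mul_sum_measureReal_dec_sub_le (β : Fin 2 → ℝ) {S L : ℝ}
    (hS : S = N + β ⬝ᵥ c.inputCorr N *ᵥ β) (hL : 0 < L) :
    Real.log L * ∑ m, (arLaw (c.predictor 1 m) N.toNNReal).real {y | c.dec y = m} -
        L * ∑ m, (arLaw (c.predictor (1 - β) m) S.toNNReal).real {y | c.dec y = m} ≤
      M 0 * M 1 * (n * awgnCap ((β ⬝ᵥ c.inputCorr N *ᵥ β) / N)) := by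
  have hS0 : 0 < S := by linarith [dotProduct_inputCorr_nonneg hL2 β]
  have hcap : 1 / 2 * Real.log (S / N) = awgnCap ((β ⬝ᵥ c.inputCorr N *ᵥ β) / N) := by
    rw [awgnCap, hS, add_div, div_self hN.ne']
  simp_rw [Finset.mul_sum, ← Finset.sum_sub_distrib]
  refine (Finset.sum_le_sum fun m _ =>
    log_mul_measureReal_dec_sub_le hN hL2 β m hS0 hL).trans_eq ?_
  simp only [hcap, Finset.sum_add_distrib, ← Finset.sum_div, sum_integral_sq_sum_input hL2,
    Finset.sum_const, Finset.card_univ, Fintype.card_fin, nsmul_eq_mul, card_messages]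
  rw [eq_sub_of_add_eq' hS.symm]
  field_simp
  ring

lemma one_sub_errorProb_mul_log_le (β : Fin 2 → ℝ) {L : ℝ} (hL : 0 < L)
    (hsum : ∀ v, L * ∑ m, (arLaw (c.predictor (1 - β) m) v).real {y | c.dec y = m} ≤
      M 0 * M 1) :
    (1 - c.errorProb N 0) * Real.log L - 1 ≤ n * awgnCap ((β ⬝ᵥ c.inputCorr N *ᵥ β) / N) := by
  have hM := c.messages_pos
  have hle := log_mul_sum_measureReal_dec_sub_le hN hL2 β rfl hL
  rw [c.one_sub_errorProb N, ← mul_le_mul_iff_of_pos_left hM, mul_sub, mul_one, ← mul_assoc,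
    ← mul_assoc, mul_one_div_cancel hM.ne', one_mul]
  linarith [hsum (N + β ⬝ᵥ c.inputCorr N *ᵥ β).toNNReal]

lemma one_sub_errorProb_mul_log_card_le {ν ν' : Fin 2} (hν : ν ≠ ν') {β : Fin 2 → ℝ}
    (hβ : β ν = 1) :
    (1 - c.errorProb N 0) * Real.log (M ν) - 1 ≤
      n * awgnCap ((β ⬝ᵥ c.inputCorr N *ᵥ β) / N) := by
  have hM : (M 0 : ℝ) * M 1 = M ν * M ν' := by
    rw [← Fin.prod_univ_two fun ν => (M ν : ℝ)]
    exact Fintype.prod_eq_mul ν ν' hν fun μ hμ => by omega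
  refine one_sub_errorProb_mul_log_le hN hL2 β (Nat.cast_pos.2 (c.card_pos ν)) fun v => ?_
  rw [hM]
  exact mul_le_mul_of_nonneg_left
    (c.sum_measureReal_dec_predictor_le hν (sub_eq_zero.2 hβ.symm) v) (Nat.cast_nonneg _)

lemma one_sub_errorProb_mul_log_card_add_le :
    (1 - c.errorProb N 0) * (Real.log (M 0) + Real.log (M 1)) - 1 ≤
      n * awgnCap ((1 ⬝ᵥ c.inputCorr N *ᵥ 1) / N) := by
  have hM (ν : Fin 2) : (M ν : ℝ) ≠ 0 := Nat.cast_ne_zero.2 (c.card_pos ν).ne'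
  rw [← Real.log_mul (hM 0) (hM 1)]
  refine one_sub_errorProb_mul_log_le hN hL2 1 c.messages_pos fun v => ?_
  rw [sub_self]
  exact mul_le_of_le_one_right c.messages_pos.le (c.sum_measureReal_dec_predictor_zero_le v)

end

end FeedbackCode

/-- Ozarow's outer bound: the union over the input correlations `ρ ∈ [0, 1]` of the pentagons of
rate pairs satisfying the three mutual-information bounds. -/
def ozOuter (P₁ P₂ N : ℝ) : Set (ℝ × ℝ) :=
  {R | ∃ ρ ∈ Set.Icc (0 : ℝ) 1,
    R.1 ≤ awgnCap (P₁ * (1 - ρ ^ 2) / N) ∧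
    R.2 ≤ awgnCap (P₂ * (1 - ρ ^ 2) / N) ∧
    R.1 + R.2 ≤ awgnCap ((P₁ + P₂ + 2 * √(P₁ * P₂) * ρ) / N)}

lemma FeedbackCode.mem_ozOuter {n : ℕ} {M : Fin 2 → ℕ} {c : FeedbackCode n M} (hn : 0 < n)
    {P₁ P₂ N : ℝ} (hP₁ : 0 < P₁) (hP₂ : 0 < P₂) (hN : 0 < N)
    (h₁ : c.PowerConstraint N 0 0 P₁) (h₂ : c.PowerConstraint N 0 1 P₂) :
    ((1 - c.errorProb N 0) * (1 / (n : ℝ) * Real.log (M 0)) - 1 / n,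
      (1 - c.errorProb N 0) * (1 / (n : ℝ) * Real.log (M 1)) - 1 / n) ∈ ozOuter P₁ P₂ N := by
  have hn' : (0 : ℝ) < n := Nat.cast_pos.2 hn
  have hL2 : ∀ m ν t, MemLp (fun z => c.input m z 0 ν t) 2 (gaussianNoise n N.toNNReal) :=
    fun m ν t => by
      fin_cases ν
      exacts [h₁.memLp m t, h₂.memLp m t]
  have hnonneg := dotProduct_inputCorr_nonneg hL2
  have hcap {x y : ℝ} {β : Fin 2 → ℝ} (hβ : β ⬝ᵥ c.inputCorr N *ᵥ β ≤ y)
      (hx : x ≤ n * awgnCap ((β ⬝ᵥ c.inputCorr N *ᵥ β) / N)) : 1 / n * x ≤ awgnCap (y / N) := by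
    rw [one_div_mul_eq_div, div_le_iff₀' hn']
    have := awgnCap_le_awgnCap (div_nonneg (hnonneg β) hN.le) (div_le_div_of_nonneg_right hβ hN.le)
    exact hx.trans (mul_le_mul_of_nonneg_left this hn'.le)
  obtain ⟨ρ, hρ, ⟨β₁, hβ₁, hle₁⟩, ⟨β₂, hβ₂, hle₂⟩, hle⟩ := exists_correlation
    (c.inputCorr_comm N 0 1) hnonneg hP₁ hP₂ h₁.inputCorr_le h₂.inputCorr_le
  have hrate₁ := hcap hle₁ (one_sub_errorProb_mul_log_card_le hN hL2 (ν' := 1) (by decide) hβ₁)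
  have hrate₂ := hcap hle₂ (one_sub_errorProb_mul_log_card_le hN hL2 (ν' := 0) (by decide) hβ₂)
  have hrate := hcap hle (one_sub_errorProb_mul_log_card_add_le hN hL2)
  refine ⟨ρ, hρ, ?_, ?_, ?_⟩
  · linarith
  · linarith
  · linarith [one_div_pos.2 hn']

lemma isClosed_ozOuter {P₁ P₂ N : ℝ} (hP₁ : 0 ≤ P₁) (hP₂ : 0 ≤ P₂) (hN : 0 ≤ N) :
    IsClosed (ozOuter P₁ P₂ N) := by
  have hsq (ρ : Set.Icc (0 : ℝ) 1) : 0 ≤ 1 - (ρ : ℝ) ^ 2 :=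
    sub_nonneg.2 (pow_le_one₀ ρ.2.1 ρ.2.2)
  have hcap {P : ℝ} (hP : 0 ≤ P) :
      Continuous fun ρ : Set.Icc (0 : ℝ) 1 => awgnCap (P * (1 - (ρ : ℝ) ^ 2) / N) :=
    continuous_awgnCap_comp (by fun_prop) fun ρ => div_nonneg (mul_nonneg hP (hsq ρ)) hN
  have hsum : Continuous fun ρ : Set.Icc (0 : ℝ) 1 =>
      awgnCap ((P₁ + P₂ + 2 * √(P₁ * P₂) * (ρ : ℝ)) / N) :=
    continuous_awgnCap_comp (by fun_prop) fun ρ => by have := ρ.2.1; positivity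
  have himage : ozOuter P₁ P₂ N = Prod.snd '' {x : Set.Icc (0 : ℝ) 1 × (ℝ × ℝ) |
      x.2.1 ≤ awgnCap (P₁ * (1 - (x.1 : ℝ) ^ 2) / N) ∧
      x.2.2 ≤ awgnCap (P₂ * (1 - (x.1 : ℝ) ^ 2) / N) ∧
      x.2.1 + x.2.2 ≤ awgnCap ((P₁ + P₂ + 2 * √(P₁ * P₂) * (x.1 : ℝ)) / N)} := by
    ext R
    exact ⟨fun ⟨ρ, hρ, h⟩ => ⟨(⟨ρ, hρ⟩, R), h, rfl⟩, fun ⟨x, h, hx⟩ => hx ▸ ⟨x.1, x.1.2, h⟩⟩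
  rw [himage]
  exact isClosedMap_snd_of_compactSpace _ <|
    (isClosed_le (by fun_prop) ((hcap hP₁).comp continuous_fst)).inter <|
      (isClosed_le (by fun_prop) ((hcap hP₂).comp continuous_fst)).inter <|
        isClosed_le (by fun_prop) (hsum.comp continuous_fst)

lemma isLowerSet_ozOuter (P₁ P₂ N : ℝ) : IsLowerSet (ozOuter P₁ P₂ N) :=
  fun _ _ hle ⟨ρ, hρ, h₁, h₂, h₃⟩ =>
    ⟨ρ, hρ, hle.1.trans h₁, hle.2.trans h₂, (add_le_add hle.1 hle.2).trans h₃⟩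

theorem capPerfectFB_subset_ozOuter {P₁ P₂ N : ℝ} (hP₁ : 0 < P₁) (hP₂ : 0 < P₂) (hN : 0 < N) :
    capPerfectFB P₁ P₂ N ⊆ ozOuter P₁ P₂ N := by
  rintro R ⟨-, -, hR⟩
  have hcl := isClosed_ozOuter hP₁.le hP₂.le hN.le
  have hmem (δ : ℝ) (hδ : 0 < δ) : (R.1 - δ, R.2 - δ) ∈ ozOuter P₁ P₂ N := by
    obtain ⟨M, c, hc, herr⟩ := hR δ hδ
    have hlim (r : ℝ) : Filter.Tendsto
        (fun n : ℕ => (1 - (c n).errorProb N 0) * (r - δ) - 1 / n) Filter.atTop (𝓝 (r - δ)) := by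
      simpa only [sub_zero, one_mul] using
        ((herr.const_sub 1).mul_const (r - δ)).sub tendsto_one_div_atTop_nhds_zero_nat
    refine hcl.mem_of_tendsto ((hlim R.1).prodMk_nhds (hlim R.2)) ?_
    filter_upwards [hc, Filter.eventually_gt_atTop 0, herr.eventually_lt_const one_pos] with
      n ⟨hpow₁, hpow₂, hrate₁, hrate₂⟩ hn herr_lt
    have hsucc : 0 ≤ 1 - (c n).errorProb N 0 := sub_nonneg.2 herr_lt.le
    refine isLowerSet_ozOuter P₁ P₂ N ⟨?_, ?_⟩ (FeedbackCode.mem_ozOuter hn hP₁ hP₂ hN hpow₁ hpow₂)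
    · exact sub_le_sub_right (mul_le_mul_of_nonneg_left hrate₁.le hsucc) _
    · exact sub_le_sub_right (mul_le_mul_of_nonneg_left hrate₂.le hsucc) _
  have hlim : Filter.Tendsto (fun δ : ℝ => (R.1 - δ, R.2 - δ)) (𝓝[>] 0) (𝓝 R) := by
    have hcont : Continuous fun δ : ℝ => (R.1 - δ, R.2 - δ) := by fun_prop
    simpa only [sub_zero] using (hcont.tendsto 0).mono_left nhdsWithin_le_nhds
  exact hcl.mem_of_tendsto hlim (Filter.eventually_of_mem self_mem_nhdsWithin hmem)

/-! ### Ozarow's rectangles -/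

lemma half_log_add_div_add {N x y : ℝ} (hN : 0 < N) (hx : 0 ≤ x) (hy : 0 ≤ y) :
    1 / 2 * Real.log ((x + N) / (y + N)) = awgnCap (x / N) - awgnCap (y / N) := by
  have hdiv (a : ℝ) : 1 + a / N = (a + N) / N := by rw [add_div, div_self hN.ne', add_comm]
  have hx' : x + N ≠ 0 := by positivity
  have hy' : y + N ≠ 0 := by positivity
  rw [awgnCap, awgnCap, hdiv, hdiv, Real.log_div hx' hy', Real.log_div hx' hN.ne',
    Real.log_div hy' hN.ne']
  ring

lemma mem_ozRect₁_iff {P₁ P₂ N ρ : ℝ} (hP₁ : 0 ≤ P₁) (hP₂ : 0 ≤ P₂) (hN : 0 < N)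
    (hρ : ρ ∈ Set.Icc (0 : ℝ) 1) {R : ℝ × ℝ} :
    R ∈ ozRect₁ P₁ P₂ N ρ ↔ 0 ≤ R.1 ∧ 0 ≤ R.2 ∧ R.1 ≤ awgnCap (P₁ * (1 - ρ ^ 2) / N) ∧
      R.2 ≤ awgnCap ((P₁ + P₂ + 2 * √(P₁ * P₂) * ρ) / N) - awgnCap (P₁ * (1 - ρ ^ 2) / N) := by
  have hρ0 := hρ.1
  have hsq : 0 ≤ 1 - ρ ^ 2 := sub_nonneg.2 (pow_le_one₀ hρ0 hρ.2)
  rw [← half_log_add_div_add hN (by positivity) (by positivity)]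
  rfl

lemma ozRect₂_eq_preimage_swap (P₁ P₂ N ρ : ℝ) :
    ozRect₂ P₁ P₂ N ρ = Prod.swap ⁻¹' ozRect₁ P₂ P₁ N ρ := by
  ext R
  simp only [ozRect₁, ozRect₂, Set.mem_preimage, Set.mem_ofPred_eq, Prod.fst_swap, Prod.snd_swap,
    mul_comm P₂ P₁, add_comm P₂ P₁]
  tauto

namespace RhoEq

variable {P₁ P₂ N ρ : ℝ}

lemma symm (h : RhoEq P₁ P₂ N ρ) : RhoEq P₂ P₁ N ρ := by
  unfold RhoEq at *
  rw [mul_comm P₂ P₁]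
  linarith

lemma awgnCap_sum_eq (h : RhoEq P₁ P₂ N ρ) (hP₁ : 0 ≤ P₁) (hP₂ : 0 ≤ P₂) (hN : 0 < N)
    (hρ : ρ ^ 2 ≤ 1) :
    awgnCap ((P₁ + P₂ + 2 * √(P₁ * P₂) * ρ) / N) =
      awgnCap (P₁ * (1 - ρ ^ 2) / N) + awgnCap (P₂ * (1 - ρ ^ 2) / N) := by
  have : 0 ≤ 1 - ρ ^ 2 := sub_nonneg.2 hρ
  have hmul : 1 + (P₁ + P₂ + 2 * √(P₁ * P₂) * ρ) / N =
      (1 + P₁ * (1 - ρ ^ 2) / N) * (1 + P₂ * (1 - ρ ^ 2) / N) := by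
    unfold RhoEq at h
    field_simp
    linarith
  rw [awgnCap, hmul, Real.log_mul (by positivity) (by positivity), mul_add]
  rfl

end RhoEq

lemma rhoStar_comm {P₁ P₂ N : ℝ} (hP₁ : 0 < P₁) (hP₂ : 0 < P₂) (hN : 0 < N) :
    rhoStar P₂ P₁ N = rhoStar P₁ P₂ N :=
  have h := rhoStar_spec hP₂ hP₁ hN
  (existsUnique_rhoEq hP₁ hP₂ hN).unique ⟨h.1, h.2.symm⟩ (rhoStar_spec hP₁ hP₂ hN)

section

variable {P₁ P₂ N ρ : ℝ} (hP₁ : 0 < P₁) (hP₂ : 0 < P₂) (hN : 0 < N)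
include hP₁ hP₂ hN

lemma exists_awgnCap_eq {R : ℝ} (hρ : ρ ∈ Set.Icc (0 : ℝ) 1)
    (hle : R ≤ awgnCap (P₁ * (1 - ρ ^ 2) / N))
    (hlt : awgnCap (P₁ * (1 - rhoStar P₁ P₂ N ^ 2) / N) < R) :
    ∃ ρ' ∈ Set.Icc ρ (rhoStar P₁ P₂ N), awgnCap (P₁ * (1 - ρ' ^ 2) / N) = R := by
  obtain ⟨hτ, -⟩ := rhoStar_spec hP₁ hP₂ hN
  set τ := rhoStar P₁ P₂ N
  have hsq {x : ℝ} (hx : x ∈ Set.Icc (0 : ℝ) 1) : 0 ≤ 1 - x ^ 2 :=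
    sub_nonneg.2 (pow_le_one₀ hx.1 hx.2)
  have hρτ : ρ ≤ τ := by
    by_contra! hτρ
    have := hsq hρ
    refine absurd (hlt.trans_le hle) (awgnCap_le_awgnCap (by positivity) ?_).not_gt
    have := hτ.1
    gcongr
  have hcont : ContinuousOn (fun x : ℝ => awgnCap (P₁ * (1 - x ^ 2) / N)) (Set.Icc ρ τ) := by
    refine .const_mul (.log (by fun_prop) fun x hx => ?_) _
    have := hsq ⟨hρ.1.trans hx.1, hx.2.trans hτ.2⟩
    positivity
  exact intermediate_value_Icc' hρτ hcont ⟨hlt.le, hle⟩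

lemma exists_mem_ozRect₁ (hρ : ρ ∈ Set.Icc (0 : ℝ) 1) {R : ℝ × ℝ} (hR₁ : 0 ≤ R.1) (hR₂ : 0 ≤ R.2)
    (hle : R.1 ≤ awgnCap (P₁ * (1 - ρ ^ 2) / N))
    (hsum : R.1 + R.2 ≤ awgnCap ((P₁ + P₂ + 2 * √(P₁ * P₂) * ρ) / N))
    (hlt : awgnCap (P₁ * (1 - rhoStar P₁ P₂ N ^ 2) / N) < R.1) :
    ∃ ρ' ∈ Set.Icc 0 (rhoStar P₁ P₂ N), R ∈ ozRect₁ P₁ P₂ N ρ' := by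
  obtain ⟨ρ', hρ', hcap⟩ := exists_awgnCap_eq hP₁ hP₂ hN hρ hle hlt
  have hρ0 := hρ.1
  have hρ'1 : ρ' ∈ Set.Icc (0 : ℝ) 1 :=
    ⟨hρ0.trans hρ'.1, hρ'.2.trans (rhoStar_spec hP₁ hP₂ hN).1.2⟩
  have hmono : awgnCap ((P₁ + P₂ + 2 * √(P₁ * P₂) * ρ) / N) ≤
      awgnCap ((P₁ + P₂ + 2 * √(P₁ * P₂) * ρ') / N) := by
    refine awgnCap_le_awgnCap (by positivity) ?_
    have := hρ'.1
    gcongr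
  exact ⟨ρ', ⟨hρ'1.1, hρ'.2⟩, (mem_ozRect₁_iff hP₁.le hP₂.le hN hρ'1).2
    ⟨hR₁, hR₂, hcap.ge, by linarith⟩⟩

lemma exists_mem_ozRect {R : ℝ × ℝ} (hR₁ : 0 ≤ R.1) (hR₂ : 0 ≤ R.2) (hR : R ∈ ozOuter P₁ P₂ N) :
    ∃ ρ ∈ Set.Icc 0 (rhoStar P₁ P₂ N), R ∈ ozRect₁ P₁ P₂ N ρ ∨ R ∈ ozRect₂ P₁ P₂ N ρ := by
  obtain ⟨ρ, hρ, hle₁, hle₂, hsum⟩ := hR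
  obtain ⟨hτ, hτeq⟩ := rhoStar_spec hP₁ hP₂ hN
  rcases lt_or_ge (awgnCap (P₁ * (1 - rhoStar P₁ P₂ N ^ 2) / N)) R.1 with hlt₁ | hge₁
  · obtain ⟨ρ', hρ', hmem⟩ := exists_mem_ozRect₁ hP₁ hP₂ hN hρ hR₁ hR₂ hle₁ hsum hlt₁
    exact ⟨ρ', hρ', Or.inl hmem⟩
  rcases lt_or_ge (awgnCap (P₂ * (1 - rhoStar P₁ P₂ N ^ 2) / N)) R.2 with hlt₂ | hge₂
  · rw [← rhoStar_comm hP₁ hP₂ hN] at hlt₂ ⊢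
    rw [mul_comm P₁, add_comm P₁, add_comm R.1] at hsum
    obtain ⟨ρ', hρ', hmem⟩ :=
      exists_mem_ozRect₁ (R := R.swap) hP₂ hP₁ hN hρ hR₂ hR₁ hle₂ hsum hlt₂
    exact ⟨ρ', hρ', Or.inr (ozRect₂_eq_preimage_swap P₁ P₂ N ρ' ▸ hmem)⟩
  · refine ⟨_, ⟨hτ.1, le_rfl⟩, Or.inl <| (mem_ozRect₁_iff hP₁.le hP₂.le hN hτ).2
      ⟨hR₁, hR₂, hge₁, ?_⟩⟩
    rwa [hτeq.awgnCap_sum_eq hP₁.le hP₂.le hN (pow_le_one₀ hτ.1 hτ.2), add_sub_cancel_left]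

lemma mul_sum_le_of_le_rhoStar (hρ : ρ ∈ Set.Icc 0 (rhoStar P₁ P₂ N)) :
    N * (N + P₁ + P₂ + 2 * √(P₁ * P₂) * ρ) ≤
      (N + P₁ * (1 - ρ ^ 2)) * (N + P₂ * (1 - ρ ^ 2)) := by
  obtain ⟨hτ, hτeq⟩ := rhoStar_spec hP₁ hP₂ hN
  have hρ0 := hρ.1
  have hle := hρ.2
  have hτsq : 0 ≤ 1 - rhoStar P₁ P₂ N ^ 2 := sub_nonneg.2 (pow_le_one₀ hτ.1 hτ.2)
  have hρsq : 0 ≤ 1 - ρ ^ 2 := sub_nonneg.2 (pow_le_one₀ hρ0 (hle.trans hτ.2))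
  calc N * (N + P₁ + P₂ + 2 * √(P₁ * P₂) * ρ)
    _ ≤ N * (N + P₁ + P₂ + 2 * √(P₁ * P₂) * rhoStar P₁ P₂ N) := by gcongr
    _ = (N + P₁ * (1 - rhoStar P₁ P₂ N ^ 2)) * (N + P₂ * (1 - rhoStar P₁ P₂ N ^ 2)) := hτeq
    _ ≤ (N + P₁ * (1 - ρ ^ 2)) * (N + P₂ * (1 - ρ ^ 2)) := by gcongr

lemma exists_mul_sum_eq (hρ : ρ ∈ Set.Ioc 0 (rhoStar P₁ P₂ N)) :
    ∃ Q ∈ Set.Ioc (P₁ * ρ ^ 2) P₁, (N + (P₁ - Q)) * (N + P₁ + P₂ + 2 * √(P₁ * P₂) * ρ) * Q =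
      (N + P₁ * (1 - ρ ^ 2)) * ((N + (P₁ - Q)) * Q + P₂ * (Q - P₁ * ρ ^ 2)) := by
  have hρ0 := hρ.1
  have hρ1 : ρ ^ 2 ≤ 1 := pow_le_one₀ hρ0.le (hρ.2.trans (rhoStar_spec hP₁ hP₂ hN).1.2)
  have hQ₀ : P₁ * ρ ^ 2 ≤ P₁ := mul_le_of_le_one_right hP₁.le hρ1
  let f (Q : ℝ) : ℝ := (N + P₁ * (1 - ρ ^ 2)) * ((N + (P₁ - Q)) * Q + P₂ * (Q - P₁ * ρ ^ 2)) -
    (N + (P₁ - Q)) * (N + P₁ + P₂ + 2 * √(P₁ * P₂) * ρ) * Q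
  have hneg : f (P₁ * ρ ^ 2) < 0 := by
    have : 0 < N + (P₁ - P₁ * ρ ^ 2) := by linarith
    have hpos : 0 < (N + (P₁ - P₁ * ρ ^ 2)) * (P₁ * ρ ^ 2) *
      (P₁ * ρ ^ 2 + P₂ + 2 * √(P₁ * P₂) * ρ) := by positivity
    linear_combination hpos
  have hnonneg : 0 ≤ f P₁ := by
    have hle := mul_sum_le_of_le_rhoStar hP₁ hP₂ hN ⟨hρ0.le, hρ.2⟩
    linear_combination P₁ * hle
  obtain ⟨Q, hQ, hfQ⟩ := intermediate_value_Ioc hQ₀ (f := f) (by fun_prop) ⟨hneg, hnonneg⟩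
  exact ⟨Q, hQ, (sub_eq_zero.1 hfQ).symm⟩

lemma exists_power_split (hρ : ρ ∈ Set.Ioc 0 (rhoStar P₁ P₂ N)) :
    ∃ Q ∈ Set.Ioc 0 P₁, ∃ r ∈ Set.Ioo (0 : ℝ) 1, Q * r ^ 2 = P₁ * ρ ^ 2 ∧
      √(Q * P₂) * r = √(P₁ * P₂) * ρ ∧ RhoEq Q P₂ (N + (P₁ - Q)) r := by
  obtain ⟨Q, ⟨hlt, hle⟩, heq⟩ := exists_mul_sum_eq hP₁ hP₂ hN hρ
  have hρ0 := hρ.1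
  have hQ : 0 < Q := lt_of_le_of_lt (by positivity) hlt
  have hr0 : 0 < ρ * √(P₁ / Q) := by positivity
  have hrsq : Q * (ρ * √(P₁ / Q)) ^ 2 = P₁ * ρ ^ 2 := by
    rw [mul_pow, Real.sq_sqrt (by positivity)]
    field_simp
  have hr1 : ρ * √(P₁ / Q) < 1 :=
    (sq_lt_one_iff₀ hr0.le).1 <| (mul_lt_iff_lt_one_right hQ).1 (hrsq.trans_lt hlt)
  have hcross : √(Q * P₂) * (ρ * √(P₁ / Q)) = √(P₁ * P₂) * ρ := by
    rw [mul_left_comm, ← Real.sqrt_mul (by positivity), mul_comm]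
    congr 2
    field_simp
  refine ⟨Q, ⟨hQ, hle⟩, ρ * √(P₁ / Q), ⟨hr0, hr1⟩, hrsq, hcross, ?_⟩
  have hfst : N + (P₁ - Q) + Q * (1 - (ρ * √(P₁ / Q)) ^ 2) = N + P₁ * (1 - ρ ^ 2) := by
    linear_combination -hrsq
  rw [RhoEq, mul_assoc 2, hcross, hfst]
  refine mul_left_cancel₀ hQ.ne' ?_
  linear_combination heq + (N + P₁ * (1 - ρ ^ 2)) * P₂ * hrsq

end

/-! ### Sending estimation errors over the channel -/

section

variable {ι : Type*} [DecidableEq ι]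

/-- The posterior precision matrix of a vector `θ` of independent standard Gaussian symbols after
the observations `⟨α s, θ⟩ + Z_s`, `s < t`, with independent noise of variance `N`. -/
def precision (N : ℝ) (α : ℕ → ι → ℝ) (t : ℕ) : Matrix ι ι ℝ :=
  1 + N⁻¹ • ∑ s ∈ Finset.range t, Matrix.vecMulVec (α s) (α s)

lemma precision_zero (N : ℝ) (α : ℕ → ι → ℝ) : precision N α 0 = 1 := by
  simp [precision]

lemma precision_succ (N : ℝ) (α : ℕ → ι → ℝ) (t : ℕ) :
    precision N α (t + 1) = precision N α t + N⁻¹ • Matrix.vecMulVec (α t) (α t) := by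
  simp [precision, Finset.sum_range_succ, add_assoc]

lemma precision_add_of_forall_eq_zero {N : ℝ} {α : ℕ → ι → ℝ} {t₀ : ℕ}
    (h : ∀ t ≥ t₀, α t = 0) (k : ℕ) : precision N α (t₀ + k) = precision N α t₀ := by
  induction k with
  | zero => rfl
  | succ k ih =>
    rw [← add_assoc, precision_succ, ih, h _ (Nat.le_add_right t₀ k), Matrix.zero_vecMulVec,
      smul_zero, add_zero]

variable {N : ℝ} (hN : 0 < N) (α : ℕ → ι → ℝ) (t : ℕ)
include hN

lemma posDef_precision [Finite ι] : (precision N α t).PosDef :=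
  Matrix.PosDef.one.add_posSemidef <| .smul
    (Matrix.posSemidef_sum _ fun s _ => by simpa using Matrix.posSemidef_vecMulVec_self_star (α s))
    (inv_nonneg.2 hN.le)

variable [Fintype ι]

lemma inv_precision_mul_sum_vecMulVec :
    (precision N α t)⁻¹ * ∑ s ∈ Finset.range t, Matrix.vecMulVec (α s) (α s) =
      N • (1 - (precision N α t)⁻¹) := by
  have hdet : IsUnit (precision N α t).det := (posDef_precision hN α t).det_pos.ne'.isUnit
  have hsum : ∑ s ∈ Finset.range t, Matrix.vecMulVec (α s) (α s) = N • (precision N α t - 1) := by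
    simp [precision, smul_smul, hN.ne']
  rw [hsum, Matrix.mul_smul, Matrix.mul_sub, Matrix.nonsing_inv_mul _ hdet, Matrix.mul_one]

lemma sum_inv_precision_mulVec_mul (ν μ : ι) :
    ∑ s ∈ Finset.range t, ((precision N α t)⁻¹ *ᵥ α s) ν * α s μ =
      N * ((1 : Matrix ι ι ℝ) ν μ - (precision N α t)⁻¹ ν μ) := by
  have h := congrFun₂ (inv_precision_mul_sum_vecMulVec hN α t) ν μ
  simpa only [Matrix.mul_sum, Matrix.mul_vecMulVec, Matrix.sum_apply, Matrix.vecMulVec_apply,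
    Matrix.smul_apply, Matrix.sub_apply, smul_eq_mul] using h

lemma sum_inv_precision_mulVec_sq (ν : ι) :
    ∑ s ∈ Finset.range t, ((precision N α t)⁻¹ *ᵥ α s) ν ^ 2 =
      N * ((precision N α t)⁻¹ ν ν - ∑ μ, (precision N α t)⁻¹ ν μ ^ 2) := by
  have h : (precision N α t)⁻¹ * ∑ s ∈ Finset.range t, Matrix.vecMulVec (α s) (α s) *
      ((precision N α t)⁻¹)ᵀ = N • (1 - (precision N α t)⁻¹) * ((precision N α t)⁻¹)ᵀ := by
    rw [← Matrix.sum_mul, ← Matrix.mul_assoc, inv_precision_mul_sum_vecMulVec hN]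
  replace h := congrFun₂ h ν ν
  simp only [Matrix.mul_sum, Matrix.vecMulVec_mul, Matrix.mul_vecMulVec, Matrix.vecMul_transpose,
    Matrix.smul_mul, Matrix.sub_mul, Matrix.one_mul] at h
  simpa only [Matrix.sum_apply, Matrix.vecMulVec_apply, ← sq, Matrix.smul_apply, Matrix.sub_apply,
    Matrix.mul_apply, Matrix.transpose_apply, smul_eq_mul] using h

end

section

variable {m n R : Type*} [Fintype m] [Fintype n] [DecidableEq m] [DecidableEq n] [CommRing R]
  {T : Matrix m n R} {J : Matrix n m R}

lemma inv_one_sub_mul_inv_mul (h : IsUnit (1 + J * T).det) :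
    (1 - T * (1 + J * T)⁻¹ * J)⁻¹ = 1 + T * J := by
  have hcomm : J * (1 + T * J) = (1 + J * T) * J := by
    rw [Matrix.mul_add, Matrix.add_mul, Matrix.mul_one, Matrix.one_mul, Matrix.mul_assoc]
  refine Matrix.inv_eq_right_inv ?_
  rw [Matrix.sub_mul, Matrix.one_mul, Matrix.mul_assoc _ J, hcomm, Matrix.mul_assoc T,
    Matrix.nonsing_inv_mul_cancel_left _ _ h, add_sub_cancel_right]

lemma one_add_mul_mul_mul_inv (h : IsUnit (1 + J * T).det) :
    (1 + T * J) * (T * (1 + J * T)⁻¹) = T := by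
  have hcomm : (1 + T * J) * T = T * (1 + J * T) := by
    rw [Matrix.mul_add, Matrix.add_mul, Matrix.mul_one, Matrix.one_mul, Matrix.mul_assoc]
  rw [← Matrix.mul_assoc, hcomm, Matrix.mul_nonsing_inv_cancel_right _ _ h]

end

lemma sum_fin_ite_lt {η : ℕ} (i : Fin η) (f : ℕ → ℝ) :
    ∑ j : Fin η, (if j < i then f j else 0) = ∑ s ∈ Finset.range i, f s := by
  simp_rw [Fin.lt_def]
  rw [Fin.sum_univ_eq_sum_range (fun j => if j < (i : ℕ) then f j else 0) η, ← Finset.sum_filter]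
  refine Finset.sum_congr (Finset.ext fun s => ?_) fun _ _ => rfl
  rw [Finset.mem_filter, Finset.mem_range, Finset.mem_range]
  exact ⟨And.right, fun h => ⟨h.trans i.2, h⟩⟩

/-- The `η × 2η` matrix `(I I)`, which adds the inputs of the two users. -/
def blockSum (η : ℕ) : Matrix (Fin η) (Fin 2 × Fin η) ℝ :=
  Matrix.of fun i y => if i = y.2 then 1 else 0

lemma blockSum_mul_apply {η : ℕ} {κ : Type*} (X : Matrix (Fin 2 × Fin η) κ ℝ) (i : Fin η) (k : κ) :
    (blockSum η * X) i k = ∑ ν, X (ν, i) k := by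
  simp [blockSum, Matrix.mul_apply, Fintype.sum_prod_type]

namespace Params

variable {η : ℕ} (p : Params η)

lemma BB_eq_Bt_mul_blockSum : p.BB = p.Bt * blockSum η := by
  ext x y
  simp [BB, Bt, blockSum, Matrix.mul_apply]

/-- The energy that user `ν` spends on one block, i.e. the trace of the `ν`-th diagonal block of
`inputCov`. -/
def inputPower (N : ℝ) (K : Matrix (Fin 2) (Fin 2) ℝ) (ν : Fin 2) : ℝ :=
  ((p.inputCov N K).submatrix (Prod.mk ν) (Prod.mk ν)).trace

lemma blockSum_mul_Ad : blockSum η * p.Ad = p.Ab := by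
  ext i μ
  simp [blockSum_mul_apply, Ad, Ab]

lemma noiseCov_zero (N : ℝ) : p.noiseCov N 0 = N • 1 := by
  simp [noiseCov]

lemma inputCov_zero (N : ℝ) :
    p.inputCov N 0 = ((1 - p.BB)⁻¹ * p.Ad) * ((1 - p.BB)⁻¹ * p.Ad)ᵀ +
      N • (((1 - p.BB)⁻¹ * p.Bt) * ((1 - p.BB)⁻¹ * p.Bt)ᵀ) := by
  simp only [inputCov, Matrix.zero_kronecker, Matrix.mul_zero, Matrix.zero_mul, add_zero,
    Matrix.mul_add, Matrix.add_mul, Matrix.transpose_mul, Matrix.mul_smul, Matrix.smul_mul,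
    Matrix.mul_assoc]

/-- When the codewords are combinations of the rows of `D`, all matrices in the rate bound are
polynomials in `D Dᵀ`. -/
lemma rateBound_zero_transpose_mul_mul {N : ℝ} (hN : N ≠ 0) {k : ℕ} {D : Matrix (Fin k) (Fin η) ℝ}
    (hD : (D * Dᵀ).det ≠ 0) (F : Matrix (Fin k) (Fin k) ℝ) :
    p.rateBound N 0 D (Dᵀ * F * D) =
      1 / (2 * (η : ℝ)) * Real.log (1 + N⁻¹ • (F * (D * Dᵀ))).det := by
  have hden : D * p.noiseCov N 0 * Dᵀ = N • (D * Dᵀ) := by simp [noiseCov_zero]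
  have hnum : D * (Dᵀ * F * D + p.noiseCov N 0) * Dᵀ =
      (N • (D * Dᵀ)) * (1 + N⁻¹ • (F * (D * Dᵀ))) := by
    simp only [Matrix.mul_add, Matrix.add_mul, hden, Matrix.mul_one, Matrix.smul_mul,
      Matrix.mul_smul, smul_smul, inv_mul_cancel₀ hN, one_smul, Matrix.mul_assoc, add_comm]
  have hne : (N • (D * Dᵀ)).det ≠ 0 := by
    rw [Matrix.det_smul]
    exact mul_ne_zero (pow_ne_zero _ hN) hD
  rw [rateBound, hnum, hden, Matrix.det_mul, mul_div_cancel_left₀ _ hne]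

end Params

section

variable (N : ℝ) (α : ℕ → Fin 2 → ℝ) (η : ℕ)

/-- The weights with which the users subtract the linear estimates of their own message symbols
from the past channel outputs, stacked over the two users. The weights refer to the outputs net of
the estimates, see `errorScheme`. -/
def estWeight : Matrix (Fin 2 × Fin η) (Fin η) ℝ :=
  Matrix.of fun x j =>
    if j < x.2 then -(α x.2 x.1 / N) * ((precision N α x.2)⁻¹ *ᵥ α j) x.1 else 0

variable {η}

lemma estWeight_of_le (ν : Fin 2) {i j : Fin η} (h : i ≤ j) : estWeight N α η (ν, i) j = 0 :=
  if_neg h.not_gt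

lemma one_add_blockSum_mul_estWeight_of_lt {i j : Fin η} (h : i < j) :
    (1 + blockSum η * estWeight N α η : Matrix (Fin η) (Fin η) ℝ) i j = 0 := by
  simp [blockSum_mul_apply, estWeight_of_le N α _ h.le, h.ne]

lemma det_one_add_blockSum_mul_estWeight : (1 + blockSum η * estWeight N α η).det = 1 := by
  rw [Matrix.det_of_isLowerTriangular _ fun i j h => one_add_blockSum_mul_estWeight_of_lt N α h]
  refine Finset.prod_eq_one fun i _ => ?_
  simp [blockSum_mul_apply, estWeight_of_le N α _ (le_refl i)]

lemma isUnit_det_one_add_blockSum_mul_estWeight :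
    IsUnit (1 + blockSum η * estWeight N α η).det :=
  det_one_add_blockSum_mul_estWeight N α ▸ isUnit_one

lemma inv_one_add_blockSum_mul_estWeight_of_lt {i j : Fin η} (h : i < j) :
    (1 + blockSum η * estWeight N α η : Matrix (Fin η) (Fin η) ℝ)⁻¹ i j = 0 := by
  have := Matrix.invertibleOfIsUnitDet _ (isUnit_det_one_add_blockSum_mul_estWeight (η := η) N α)
  exact Matrix.blockTriangular_inv_of_blockTriangular (b := OrderDual.toDual)
    (fun i j h => one_add_blockSum_mul_estWeight_of_lt N α h) h

/-- The scheme in which, in the absence of feedback noise, user `ν` transmits `α t ν` times the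
error of the linear MMSE estimate of its message symbol from the channel outputs up to time `t`. The
inverse expresses the estimates in terms of the raw channel outputs. -/
def errorScheme (η : ℕ) : Params η where
  a ν i := α i ν
  B ν := Matrix.of fun i j =>
    (estWeight N α η * (1 + blockSum η * estWeight N α η)⁻¹ :
      Matrix (Fin 2 × Fin η) (Fin η) ℝ) (ν, i) j
  C := Matrix.of fun ν i => α i ν
  strictLower ν i j h := by
    rw [Matrix.of_apply, Matrix.mul_apply]
    refine Finset.sum_eq_zero fun k _ => ?_
    rcases lt_or_ge k i with hk | hk
    · rw [inv_one_add_blockSum_mul_estWeight_of_lt N α (hk.trans_le h), mul_zero]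
    · rw [estWeight_of_le N α ν hk, zero_mul]

lemma inv_one_sub_BB_errorScheme :
    (1 - (errorScheme N α η).BB)⁻¹ = 1 + estWeight N α η * blockSum η := by
  rw [Params.BB_eq_Bt_mul_blockSum]
  exact inv_one_sub_mul_inv_mul (isUnit_det_one_add_blockSum_mul_estWeight N α)

lemma inv_one_sub_BB_mul_Bt_errorScheme :
    (1 - (errorScheme N α η).BB)⁻¹ * (errorScheme N α η).Bt = estWeight N α η := by
  rw [inv_one_sub_BB_errorScheme]
  exact one_add_mul_mul_mul_inv (isUnit_det_one_add_blockSum_mul_estWeight N α)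

variable {N} (hN : 0 < N)
include hN

lemma inv_one_sub_BB_mul_Ad_errorScheme_apply (ν μ : Fin 2) (i : Fin η) :
    ((1 - (errorScheme N α η).BB)⁻¹ * (errorScheme N α η).Ad : Matrix (Fin 2 × Fin η) (Fin 2) ℝ)
      (ν, i) μ =
      α i ν * (precision N α i)⁻¹ ν μ := by
  have hAd : (errorScheme N α η).Ad (ν, i) μ = α i ν * (1 : Matrix (Fin 2) (Fin 2) ℝ) ν μ := by
    simp [Params.Ad, errorScheme, Matrix.one_apply]
  have hest (j : Fin η) : estWeight N α η (ν, i) j * (errorScheme N α η).Ab j μ =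
      if j < i then -(α i ν / N) * (((precision N α i)⁻¹ *ᵥ α j) ν * α j μ) else 0 := by
    simp only [estWeight, Params.Ab, errorScheme, Matrix.of_apply, ite_mul, zero_mul, mul_assoc]
  rw [inv_one_sub_BB_errorScheme, Matrix.add_mul, Matrix.one_mul, Matrix.mul_assoc,
    Params.blockSum_mul_Ad, Matrix.add_apply, Matrix.mul_apply, hAd]
  simp_rw [hest]
  rw [sum_fin_ite_lt i fun s => -(α i ν / N) * (((precision N α i)⁻¹ *ᵥ α s) ν * α s μ),
    ← Finset.mul_sum, sum_inv_precision_mulVec_mul hN]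
  field_simp
  ring

lemma sum_estWeight_sq (ν : Fin 2) (i : Fin η) :
    N * ∑ j, estWeight N α η (ν, i) j ^ 2 =
      α i ν ^ 2 * ((precision N α i)⁻¹ ν ν - ∑ μ, (precision N α i)⁻¹ ν μ ^ 2) := by
  have hest (j : Fin η) : estWeight N α η (ν, i) j ^ 2 =
      if j < i then (α i ν / N) ^ 2 * ((precision N α i)⁻¹ *ᵥ α j) ν ^ 2 else 0 := by
    simp only [estWeight, Matrix.of_apply, ite_pow, mul_pow, neg_sq, zero_pow two_ne_zero]
  simp_rw [hest]
  rw [sum_fin_ite_lt i fun s => (α i ν / N) ^ 2 * ((precision N α i)⁻¹ *ᵥ α s) ν ^ 2,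
    ← Finset.mul_sum, sum_inv_precision_mulVec_sq hN]
  field_simp

lemma inputCov_errorScheme_diag (ν : Fin 2) (i : Fin η) :
    (errorScheme N α η).inputCov N 0 (ν, i) (ν, i) = α i ν ^ 2 * (precision N α i)⁻¹ ν ν := by
  rw [Params.inputCov_zero, Matrix.add_apply, Matrix.smul_apply, Matrix.mul_apply,
    Matrix.mul_apply]
  simp only [Matrix.transpose_apply, inv_one_sub_BB_mul_Ad_errorScheme_apply α hN,
    inv_one_sub_BB_mul_Bt_errorScheme, ← sq, mul_pow, ← Finset.mul_sum, smul_eq_mul,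
    sum_estWeight_sq α hN]
  ring

lemma inputPower_errorScheme (ν : Fin 2) :
    (errorScheme N α η).inputPower N 0 ν =
      ∑ t ∈ Finset.range η, α t ν ^ 2 * (precision N α t)⁻¹ ν ν := by
  rw [← Fin.sum_univ_eq_sum_range fun t => α t ν ^ 2 * (precision N α t)⁻¹ ν ν, Params.inputPower,
    Matrix.trace]
  exact Finset.sum_congr rfl fun i _ => inputCov_errorScheme_diag α hN ν i

omit hN

lemma one_add_smul_C_mul_transpose_errorScheme :
    1 + N⁻¹ • ((errorScheme N α η).C * (errorScheme N α η).Cᵀ) = precision N α η := by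
  ext μ ν
  simp [precision, errorScheme, Matrix.mul_apply, Matrix.sum_apply, Matrix.vecMulVec_apply,
    Fin.sum_univ_eq_sum_range (fun s => α s μ * α s ν)]

lemma det_C_mul_transpose_errorScheme_ne_zero {s t : Fin η}
    (h : α s 0 * α t 1 - α s 1 * α t 0 ≠ 0) :
    ((errorScheme N α η).C * (errorScheme N α η).Cᵀ).det ≠ 0 := by
  refine (Matrix.PosDef.mul_conjTranspose_self (errorScheme N α η).C fun v w hvw => ?_).det_pos.ne'
  have hs := congrFun hvw s
  have ht := congrFun hvw t
  simp only [errorScheme, Matrix.vecMul, dotProduct, Fin.sum_univ_two, Matrix.of_apply] at hs ht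
  refine funext <| Fin.forall_fin_two.2 ⟨mul_left_cancel₀ h ?_, mul_left_cancel₀ h ?_⟩
  · linear_combination α t 1 * hs - α s 1 * ht
  · linear_combination α s 0 * ht - α t 0 * hs

variable (hdet : ((errorScheme N α η).C * (errorScheme N α η).Cᵀ).det ≠ 0)
include hN hdet

lemma rateBound_errorScheme_joint :
    (errorScheme N α η).rateBound N 0 (errorScheme N α η).C
      ((errorScheme N α η).Ab * (errorScheme N α η).Abᵀ) =
      1 / (2 * (η : ℝ)) * Real.log (precision N α η).det := by
  have hAb : (errorScheme N α η).Ab * (errorScheme N α η).Abᵀ =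
      (errorScheme N α η).Cᵀ * (1 : Matrix (Fin 2) (Fin 2) ℝ) * (errorScheme N α η).C := by
    rw [Matrix.mul_one]
    rfl
  rw [hAb, Params.rateBound_zero_transpose_mul_mul _ hN.ne' hdet, Matrix.one_mul,
    one_add_smul_C_mul_transpose_errorScheme]

lemma rateBound_errorScheme_single (ν : Fin 2) :
    (errorScheme N α η).rateBound N 0 (errorScheme N α η).C
      (Matrix.vecMulVec ((errorScheme N α η).a ν) ((errorScheme N α η).a ν)) =
      1 / (2 * (η : ℝ)) * Real.log (precision N α η ν ν) := by
  have ha : Matrix.vecMulVec ((errorScheme N α η).a ν) ((errorScheme N α η).a ν) =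
      (errorScheme N α η).Cᵀ * Matrix.single ν ν (1 : ℝ) * (errorScheme N α η).C := by
    ext i j
    fin_cases ν <;> simp [errorScheme, Matrix.vecMulVec_apply, Matrix.mul_apply]
  rw [ha, Params.rateBound_zero_transpose_mul_mul _ hN.ne' hdet,
    ← one_add_smul_C_mul_transpose_errorScheme]
  congr 2
  generalize (errorScheme N α η).C * (errorScheme N α η).Cᵀ = W
  fin_cases ν <;> simp [Matrix.det_fin_two]

end

/-! ### Ozarow's feedback scheme -/

section

variable (P : Fin 2 → ℝ) (N ρ : ℝ)

/-- The factor by which one use of the channel in Ozarow's scheme multiplies the precision of the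
symbol of user `ν`. -/
def ozFactor (ν : Fin 2) : ℝ :=
  1 + P ν * (1 - ρ ^ 2) / N

/-- The amplitudes of Ozarow's scheme with `n` refinement steps. The users first send their symbols
with a common amplitude chosen to give their estimation errors the correlation `-ρ`. From then on
the second user alternates its sign, so that the inputs always have correlation `ρ`. -/
def ozGain (n : ℕ) : ℕ → Fin 2 → ℝ
  | 0, _ => √(N * ρ / (1 - ρ))
  | t + 1, ν =>
    if t < n then √(P ν * (1 + ρ)) * ((![1, -1] ν) ^ (t + 1) * √(ozFactor P N ρ ν) ^ t) else 0

/-- Ozarow's scheme with `n` refinement steps, followed by `k` idle channel uses, over which the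
energy of the first transmission is averaged out. -/
abbrev ozScheme (n k : ℕ) : Params (n + 1 + k) :=
  errorScheme N (ozGain P N ρ n) (n + 1 + k)

variable {P N ρ} in
lemma ozGain_of_lt {n t : ℕ} (h : n < t) : ozGain P N ρ n t = 0 := by
  obtain ⟨t, rfl⟩ := Nat.exists_eq_succ_of_ne_zero (Nat.ne_zero_of_lt h)
  ext ν
  exact if_neg (Nat.lt_succ_iff.1 h).not_gt

end

section

variable {P : Fin 2 → ℝ} {N ρ : ℝ} (hP : ∀ ν, 0 < P ν) (hN : 0 < N) (hρ : ρ ∈ Set.Ioo (0 : ℝ) 1)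
include hP hN hρ

lemma one_lt_ozFactor (ν : Fin 2) : 1 < ozFactor P N ρ ν := by
  have hq : 0 < 1 - ρ ^ 2 := by nlinarith [hρ.1, hρ.2]
  exact lt_add_of_pos_right 1 (div_pos (mul_pos (hP ν) hq) hN)

lemma ozFactor_pos (ν : Fin 2) : 0 < ozFactor P N ρ ν :=
  one_pos.trans (one_lt_ozFactor hP hN hρ ν)

omit hP in
lemma ozGain_zero_sq (n : ℕ) (ν : Fin 2) : ozGain P N ρ n 0 ν ^ 2 = N * ρ / (1 - ρ) :=
  Real.sq_sqrt (div_nonneg (mul_pos hN hρ.1).le (sub_pos.2 hρ.2).le)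

lemma ozGain_succ_sq {n t : ℕ} (ht : t < n) (ν : Fin 2) :
    ozGain P N ρ n (t + 1) ν ^ 2 = P ν * (1 + ρ) * ozFactor P N ρ ν ^ t := by
  have hsign : (![1, -1] ν : ℝ) ^ 2 = 1 := by fin_cases ν <;> norm_num
  rw [ozGain, if_pos ht, mul_pow, mul_pow, pow_right_comm (![1, -1] ν), hsign, one_pow, one_mul,
    pow_right_comm (√_), Real.sq_sqrt (ozFactor_pos hP hN hρ ν).le,
    Real.sq_sqrt (mul_nonneg (hP ν).le (by linarith [hρ.1]))]

omit hN in
lemma ozGain_succ_mul {n t : ℕ} (ht : t < n) :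
    ozGain P N ρ n (t + 1) 0 * ozGain P N ρ n (t + 1) 1 =
      -(√(P 0 * P 1) * (1 + ρ) * (-(√(ozFactor P N ρ 0) * √(ozFactor P N ρ 1))) ^ t) := by
  have hroot : √(1 + ρ) * √(1 + ρ) = 1 + ρ := Real.mul_self_sqrt (by linarith [hρ.1])
  simp only [ozGain, if_pos ht, Real.sqrt_mul (hP _).le, Matrix.cons_val_zero, Matrix.cons_val_one,
    one_pow, neg_pow (√(ozFactor P N ρ 0) * _), mul_pow, pow_succ (-1 : ℝ)]
  linear_combination (-√(P 0) * √(P 1) * (-1) ^ t * √(ozFactor P N ρ 0) ^ t *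
    √(ozFactor P N ρ 1) ^ t) * hroot

variable (h : RhoEq (P 0) (P 1) N ρ)
include h

/-- This is the form in which `RhoEq` makes the error correlation alternate between `-ρ` and `ρ`. -/
lemma RhoEq.mul_sqrt_ozFactor_add_one :
    ρ * (√(ozFactor P N ρ 0) * √(ozFactor P N ρ 1) + 1) = √(P 0 * P 1) * (1 - ρ ^ 2) / N := by
  have hs : 0 < √(P 0 * P 1) := Real.sqrt_pos.2 (mul_pos (hP 0) (hP 1))
  have hs2 : √(P 0 * P 1) ^ 2 = P 0 * P 1 := Real.sq_sqrt (mul_pos (hP 0) (hP 1)).le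
  have hq : 0 < 1 - ρ ^ 2 := by nlinarith [hρ.1, hρ.2]
  have hsum : N * (P 0 + P 1) * ρ ^ 2 + 2 * N * √(P 0 * P 1) * ρ =
      √(P 0 * P 1) ^ 2 * (1 - ρ ^ 2) ^ 2 := by
    rw [RhoEq] at h
    rw [hs2]
    linear_combination h
  have hle : N * ρ ≤ √(P 0 * P 1) * (1 - ρ ^ 2) := by
    have hNP : 0 ≤ N * (P 0 + P 1) * ρ ^ 2 := by
      have := hP 0
      have := hP 1
      positivity
    have hNρ : 2 * N * ρ ≤ √(P 0 * P 1) * (1 - ρ ^ 2) ^ 2 :=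
      le_of_mul_le_mul_left (by linarith) hs
    nlinarith [mul_pos hN hρ.1, mul_nonneg (mul_pos hs hq).le (sq_nonneg ρ)]
  have hsq : ρ ^ 2 * (ozFactor P N ρ 0 * ozFactor P N ρ 1) =
      (√(P 0 * P 1) * (1 - ρ ^ 2) / N - ρ) ^ 2 := by
    simp only [ozFactor]
    field_simp
    linear_combination (1 - ρ ^ 2) * hsum - (1 - ρ ^ 2) ^ 2 * ρ ^ 2 * hs2
  have hw : 0 ≤ √(P 0 * P 1) * (1 - ρ ^ 2) / N - ρ :=
    sub_nonneg.2 ((le_div_iff₀ hN).2 (by linarith))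
  have hsqrt := congrArg Real.sqrt hsq
  rw [Real.sqrt_mul (sq_nonneg ρ), Real.sqrt_sq hρ.1.le, Real.sqrt_sq hw,
    Real.sqrt_mul (ozFactor_pos hP hN hρ 0).le] at hsqrt
  linear_combination hsqrt

/-- After `t` refinement steps the correlation coefficient of the estimation errors is
`(-1) ^ (t + 1) * ρ`. -/
lemma precision_ozGain {n t : ℕ} (ht : t ≤ n) :
    precision N (ozGain P N ρ n) (t + 1) = (1 - ρ)⁻¹ •
      !![ozFactor P N ρ 0 ^ t, ρ * (-(√(ozFactor P N ρ 0) * √(ozFactor P N ρ 1))) ^ t;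
        ρ * (-(√(ozFactor P N ρ 0) * √(ozFactor P N ρ 1))) ^ t, ozFactor P N ρ 1 ^ t] := by
  have hρ1 : 1 - ρ ≠ 0 := (sub_pos.2 hρ.2).ne'
  induction t with
  | zero =>
    have hx (ν μ : Fin 2) :
        ozGain P N ρ n 0 ν * ozGain P N ρ n 0 μ = N * ρ / (1 - ρ) := by
      rw [← ozGain_zero_sq hN hρ n ν, sq]
      rfl
    rw [precision_succ, precision_zero]
    simp only [← Matrix.ext_iff, Fin.forall_fin_two, Matrix.add_apply, Matrix.smul_apply,
      Matrix.vecMulVec_apply, Matrix.of_apply, Matrix.cons_val_zero, Matrix.cons_val_one,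
      smul_eq_mul, hx, Matrix.one_apply_eq, Matrix.one_apply_ne, ne_eq, zero_ne_one, one_ne_zero,
      not_false_eq_true, pow_zero]
    refine ⟨⟨?_, ?_⟩, ?_, ?_⟩ <;> field_simp <;> ring
  | succ t ih =>
    have hstep (ν : Fin 2) : N⁻¹ * ozGain P N ρ n (t + 1) ν ^ 2 =
        (1 - ρ)⁻¹ * (ozFactor P N ρ ν ^ (t + 1) - ozFactor P N ρ ν ^ t) := by
      rw [ozGain_succ_sq hP hN hρ ht, pow_succ, ← mul_sub_one, ozFactor]
      field_simp
      ring
    have hcross : N⁻¹ * (ozGain P N ρ n (t + 1) 0 * ozGain P N ρ n (t + 1) 1) =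
        (1 - ρ)⁻¹ * ρ * ((-(√(ozFactor P N ρ 0) * √(ozFactor P N ρ 1))) ^ (t + 1) -
          (-(√(ozFactor P N ρ 0) * √(ozFactor P N ρ 1))) ^ t) := by
      have hroot := h.mul_sqrt_ozFactor_add_one hP hN hρ
      rw [ozGain_succ_mul hP hρ ht]
      field_simp at hroot ⊢
      linear_combination (-(√(ozFactor P N ρ 0) * √(ozFactor P N ρ 1))) ^ t * hroot
    rw [precision_succ, ih (Nat.le_of_succ_le ht)]
    simp only [← Matrix.ext_iff, Fin.forall_fin_two, Matrix.add_apply, Matrix.smul_apply,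
      Matrix.vecMulVec_apply, Matrix.of_apply, Matrix.cons_val_zero, Matrix.cons_val_one,
      smul_eq_mul]
    refine ⟨⟨?_, ?_⟩, ?_, ?_⟩
    · linear_combination hstep 0
    · linear_combination hcross
    · linear_combination hcross
    · linear_combination hstep 1

lemma det_precision_ozGain {n t : ℕ} (ht : t ≤ n) :
    (precision N (ozGain P N ρ n) (t + 1)).det =
      (1 + ρ) / (1 - ρ) * (ozFactor P N ρ 0 * ozFactor P N ρ 1) ^ t := by
  have hρ1 : 1 - ρ ≠ 0 := (sub_pos.2 hρ.2).ne'
  have hroot : (√(ozFactor P N ρ 0) * √(ozFactor P N ρ 1)) ^ 2 =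
      ozFactor P N ρ 0 * ozFactor P N ρ 1 := by
    rw [mul_pow, Real.sq_sqrt (ozFactor_pos hP hN hρ 0).le,
      Real.sq_sqrt (ozFactor_pos hP hN hρ 1).le]
  rw [precision_ozGain hP hN hρ h ht, Matrix.det_smul, Matrix.det_fin_two_of, mul_mul_mul_comm ρ,
    ← sq, ← sq, pow_right_comm, neg_sq, hroot, mul_pow, Fintype.card_fin]
  field_simp
  ring

lemma inv_precision_ozGain_diag {n t : ℕ} (ht : t ≤ n) (ν : Fin 2) :
    (precision N (ozGain P N ρ n) (t + 1))⁻¹ ν ν = ((1 + ρ) * ozFactor P N ρ ν ^ t)⁻¹ := by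
  have hρ1 : 1 - ρ ≠ 0 := (sub_pos.2 hρ.2).ne'
  have hρ2 : 1 + ρ ≠ 0 := by linarith [hρ.1]
  have hne (μ : Fin 2) := (ozFactor_pos hP hN hρ μ).ne'
  have h0 := hne 0
  have h1 := hne 1
  rw [Matrix.inv_def, det_precision_ozGain hP hN hρ h ht, precision_ozGain hP hN hρ h ht,
    Ring.inverse_eq_inv', Matrix.adjugate_fin_two, mul_pow]
  fin_cases ν <;> simp <;> field_simp

lemma inputPower_ozScheme (n k : ℕ) (ν : Fin 2) :
    (ozScheme P N ρ n k).inputPower N 0 ν =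
      N * ρ / (1 - ρ) + n * P ν := by
  have hρ2 : 1 + ρ ≠ 0 := by linarith [hρ.1]
  have hinit : ozGain P N ρ n 0 ν ^ 2 * (precision N (ozGain P N ρ n) 0)⁻¹ ν ν =
      N * ρ / (1 - ρ) := by
    rw [ozGain_zero_sq hN hρ, precision_zero, inv_one, Matrix.one_apply_eq, mul_one]
  have hstep {t : ℕ} (ht : t ∈ Finset.range n) : ozGain P N ρ n (t + 1) ν ^ 2 *
      (precision N (ozGain P N ρ n) (t + 1))⁻¹ ν ν = P ν := by
    rw [ozGain_succ_sq hP hN hρ (Finset.mem_range.1 ht), mul_assoc (P ν),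
      inv_precision_ozGain_diag hP hN hρ h (Finset.mem_range.1 ht).le, mul_inv_cancel_right₀]
    exact mul_ne_zero hρ2 (pow_ne_zero t (ozFactor_pos hP hN hρ ν).ne')
  have hidle (t : ℕ) : ozGain P N ρ n (n + 1 + t) ν ^ 2 *
      (precision N (ozGain P N ρ n) (n + 1 + t))⁻¹ ν ν = 0 := by
    rw [ozGain_of_lt (by omega), Pi.zero_apply, zero_pow two_ne_zero, zero_mul]
  rw [inputPower_errorScheme _ hN, Finset.sum_range_add, Finset.sum_range_succ', hinit,
    Finset.sum_congr rfl fun t ht => hstep ht]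
  simp only [hidle, Finset.sum_const, Finset.card_range, nsmul_eq_mul, mul_zero, add_zero]
  exact add_comm _ _

omit h in
lemma det_C_mul_transpose_ozScheme_ne_zero {n : ℕ} (hn : 0 < n) (k : ℕ) :
    ((ozScheme P N ρ n k).C *
      (ozScheme P N ρ n k).Cᵀ).det ≠ 0 := by
  have hx : 0 < √(N * ρ / (1 - ρ)) :=
    Real.sqrt_pos.2 (div_pos (mul_pos hN hρ.1) (sub_pos.2 hρ.2))
  have hκ (ν : Fin 2) : 0 < √(P ν * (1 + ρ)) :=
    Real.sqrt_pos.2 (mul_pos (hP ν) (by linarith [hρ.1]))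
  refine det_C_mul_transpose_errorScheme_ne_zero _ (s := ⟨0, by omega⟩) (t := ⟨1, by omega⟩) ?_
  have hminor : ozGain P N ρ n 0 0 * ozGain P N ρ n 1 1 - ozGain P N ρ n 0 1 * ozGain P N ρ n 1 0 =
      -(√(N * ρ / (1 - ρ)) * (√(P 0 * (1 + ρ)) + √(P 1 * (1 + ρ)))) := by
    simp only [ozGain, if_pos hn, zero_add, pow_one, pow_zero, mul_one, Matrix.cons_val_zero,
      Matrix.cons_val_one]
    ring
  exact hminor ▸ (neg_neg_of_pos (mul_pos hx (add_pos (hκ 0) (hκ 1)))).ne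

lemma rateBound_ozScheme_joint {n : ℕ} (hn : 0 < n) (k : ℕ) :
    (ozScheme P N ρ n k).rateBound N 0
      (ozScheme P N ρ n k).C
      ((ozScheme P N ρ n k).Ab *
        (ozScheme P N ρ n k).Abᵀ) =
      1 / (2 * ((n + 1 + k : ℕ) : ℝ)) *
        Real.log ((1 + ρ) / (1 - ρ) * (ozFactor P N ρ 0 * ozFactor P N ρ 1) ^ n) := by
  rw [rateBound_errorScheme_joint _ hN (det_C_mul_transpose_ozScheme_ne_zero hP hN hρ hn k),
    precision_add_of_forall_eq_zero fun t ht => ozGain_of_lt ht,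
    det_precision_ozGain hP hN hρ h le_rfl]

lemma rateBound_ozScheme_single {n : ℕ} (hn : 0 < n) (k : ℕ) (ν : Fin 2) :
    (ozScheme P N ρ n k).rateBound N 0
      (ozScheme P N ρ n k).C
      (Matrix.vecMulVec ((ozScheme P N ρ n k).a ν)
        ((ozScheme P N ρ n k).a ν)) =
      1 / (2 * ((n + 1 + k : ℕ) : ℝ)) * Real.log ((1 - ρ)⁻¹ * ozFactor P N ρ ν ^ n) := by
  rw [rateBound_errorScheme_single _ hN (det_C_mul_transpose_ozScheme_ne_zero hP hN hρ hn k),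
    precision_add_of_forall_eq_zero fun t ht => ozGain_of_lt ht,
    precision_ozGain hP hN hρ h le_rfl]
  fin_cases ν <;> rfl

end

lemma tendsto_log_mul_pow_div {c l : ℝ} (hc : 0 < c) (hl : 0 < l) (k : ℕ) :
    Filter.Tendsto (fun n : ℕ => 1 / (2 * ((n + k : ℕ) : ℝ)) * Real.log (c * l ^ n))
      Filter.atTop (𝓝 (1 / 2 * Real.log l)) := by
  have hinv : Filter.Tendsto (fun n : ℕ => 1 / ((n + k : ℕ) : ℝ)) Filter.atTop (𝓝 0) :=
    (tendsto_one_div_atTop_nhds_zero_nat (𝕜 := ℝ)).comp (Filter.tendsto_add_atTop_nat k)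
  have hlim := (hinv.const_mul ((Real.log c - k * Real.log l) / 2)).add_const (1 / 2 * Real.log l)
  rw [mul_zero, zero_add] at hlim
  refine hlim.congr' ?_
  filter_upwards [Filter.eventually_gt_atTop 0] with n hn
  have hnk : (n : ℝ) + k ≠ 0 := by positivity
  rw [Real.log_mul hc.ne' (pow_pos hl n).ne', Real.log_pow]
  push_cast
  field_simp
  ring

/-- With noise-free feedback, the power constraints `P` and the three rate constraints at the rates
`R` all hold with slack. These conditions are open, so they persist under small feedback noise. -/
structure Params.StrictlyAchieves {η : ℕ} (p : Params η) (P : Fin 2 → ℝ) (N : ℝ)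
    (R : Fin 2 → ℝ) : Prop where
  det_ne_zero : (p.C * p.Cᵀ).det ≠ 0
  inputPower_lt : ∀ ν, p.inputPower N 0 ν < η * P ν
  lt_rateBound : ∀ ν, R ν < p.rateBound N 0 p.C (Matrix.vecMulVec (p.a ν) (p.a ν))
  sum_lt_rateBound : R 0 + R 1 < p.rateBound N 0 p.C (p.Ab * p.Abᵀ)

lemma exists_strictlyAchieves {P : Fin 2 → ℝ} {N ρ : ℝ} (hP : ∀ ν, 0 < P ν) (hN : 0 < N)
    (hρ : ρ ∈ Set.Ioo (0 : ℝ) 1) (h : RhoEq (P 0) (P 1) N ρ) {R : Fin 2 → ℝ}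
    (hR : ∀ ν, R ν < awgnCap (P ν * (1 - ρ ^ 2) / N)) :
    ∃ η > 0, ∃ p : Params η, p.StrictlyAchieves P N R := by
  have hρ1 : 0 < 1 - ρ := sub_pos.2 hρ.2
  have hρ2 : 0 < 1 + ρ := by linarith [hρ.1]
  have hl := ozFactor_pos hP hN hρ
  have hidle (ν : Fin 2) : ∃ k₀ : ℕ, ∀ k ≥ k₀, N * ρ / (1 - ρ) < (1 + k) * P ν := by
    obtain ⟨k₀, hk₀⟩ := exists_nat_gt (N * ρ / (1 - ρ) / P ν)
    refine ⟨k₀, fun k hk => (div_lt_iff₀ (hP ν)).1 (hk₀.trans_le ?_)⟩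
    exact (Nat.cast_le.2 hk).trans (le_add_of_nonneg_left zero_le_one)
  choose k₀ hk₀ using hidle
  let k := max (k₀ 0) (k₀ 1)
  have hk (ν : Fin 2) : N * ρ / (1 - ρ) < (1 + k) * P ν := by
    refine hk₀ ν k ?_
    fin_cases ν
    · exact le_max_left _ _
    · exact le_max_right _ _
  have hsingle (ν : Fin 2) := (tendsto_log_mul_pow_div (inv_pos.2 hρ1) (hl ν) (1 + k))
    |>.eventually_const_lt (hR ν)
  have hsum : R 0 + R 1 < 1 / 2 * Real.log (ozFactor P N ρ 0 * ozFactor P N ρ 1) := by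
    rw [Real.log_mul (hl 0).ne' (hl 1).ne', mul_add]
    exact add_lt_add (hR 0) (hR 1)
  have hjoint := (tendsto_log_mul_pow_div (div_pos hρ2 hρ1) (mul_pos (hl 0) (hl 1)) (1 + k))
    |>.eventually_const_lt hsum
  obtain ⟨n, hn, h0, h1, h01⟩ := ((Filter.eventually_gt_atTop 0).and
    ((hsingle 0).and ((hsingle 1).and hjoint))).exists
  refine ⟨n + 1 + k, by positivity, ozScheme P N ρ n k,
    det_C_mul_transpose_ozScheme_ne_zero hP hN hρ hn k, fun ν => ?_,
    Fin.forall_fin_two.2 ⟨?_, ?_⟩, ?_⟩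
  · rw [inputPower_ozScheme hP hN hρ h]
    push_cast
    linarith [hk ν]
  · rwa [rateBound_ozScheme_single hP hN hρ h hn, add_assoc]
  · rwa [rateBound_ozScheme_single hP hN hρ h hn, add_assoc]
  · rwa [rateBound_ozScheme_joint hP hN hρ h hn, add_assoc]

/-! ### Vanishing feedback noise -/

lemma continuous_kronecker_right {ι κ : Type*} (A : Matrix κ κ ℝ) :
    Continuous fun K : Matrix ι ι ℝ => K ⊗ₖ A :=
  continuous_matrix fun i j => by
    simp only [Matrix.kroneckerMap_apply]
    fun_prop

namespace Params

variable {η : ℕ} (p : Params η) (N : ℝ)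

lemma continuous_noiseCov : Continuous (p.noiseCov N) := by
  have hK := continuous_kronecker_right (ι := Fin 2) (1 : Matrix (Fin η) (Fin η) ℝ)
  unfold noiseCov
  fun_prop

lemma continuous_inputPower (ν : Fin 2) : Continuous fun K => p.inputPower N K ν := by
  have hK := continuous_kronecker_right (ι := Fin 2) (1 : Matrix (Fin η) (Fin η) ℝ)
  unfold inputPower inputCov
  fun_prop

variable {N}

/-- The hypothesis ensures that the quotient inside the logarithm does not degenerate. -/
lemma continuousAt_rateBound {k : ℕ} {D : Matrix (Fin k) (Fin η) ℝ} {S : Matrix (Fin η) (Fin η) ℝ}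
    {K₀ : Matrix (Fin 2) (Fin 2) ℝ} (h : p.rateBound N K₀ D S ≠ 0) :
    ContinuousAt (fun K => p.rateBound N K D S) K₀ := by
  have hcov := p.continuous_noiseCov N
  have hquot : (D * (S + p.noiseCov N K₀) * Dᵀ).det / (D * p.noiseCov N K₀ * Dᵀ).det ≠ 0 :=
    fun h0 => h (by rw [rateBound, h0, Real.log_zero, mul_zero])
  have hnum : Continuous fun K => (D * (S + p.noiseCov N K) * Dᵀ).det := by fun_prop
  have hden : Continuous fun K => (D * p.noiseCov N K * Dᵀ).det := by fun_prop
  exact continuousAt_const.mul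
    ((hnum.continuousAt.div hden.continuousAt (div_ne_zero_iff.1 hquot).2).log hquot)

lemma nfBound_eq_rateBound (P' : ℝ) (K : Matrix (Fin 2) (Fin 2) ℝ) :
    p.nfBound P' N K = p.rateBound N K (1 : Matrix (Fin η) (Fin η) ℝ) (P' • 1) := by
  simp only [nfBound, rateBound, Matrix.transpose_one, Matrix.one_mul, Matrix.mul_one]

lemma nfBound_of_noiseCov_eq (hη : 0 < η) (hN : N ≠ 0) {K : Matrix (Fin 2) (Fin 2) ℝ}
    (hK : p.noiseCov N K = N • 1) (P' : ℝ) : p.nfBound P' N K = awgnCap (P' / N) := by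
  rw [nfBound, hK, ← add_smul, Matrix.det_smul, Matrix.det_smul, Matrix.det_one,
    Fintype.card_fin, mul_one, mul_one, ← div_pow, Real.log_pow, awgnCap, add_div, div_self hN,
    add_comm]
  field_simp

lemma eventually_mul_awgnCap_le_nfBound (hη : 0 < η) {P' c : ℝ} (hP' : 0 ≤ P') (hN : 0 < N)
    (hc : c < 1) : ∀ᶠ K in 𝓝 0, c * awgnCap (P' / N) ≤ p.nfBound P' N K := by
  rcases hP'.eq_or_lt with rfl | hpos
  · exact .of_forall fun K => by simp [nfBound, awgnCap]
  · have hzero := p.nfBound_of_noiseCov_eq hη hN.ne' (p.noiseCov_zero N) P'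
    have hcap := awgnCap_pos (div_pos hpos hN)
    simp only [nfBound_eq_rateBound] at hzero ⊢
    have hlt : c * awgnCap (P' / N) < p.rateBound N 0 (1 : Matrix (Fin η) (Fin η) ℝ) (P' • 1) :=
      (mul_lt_of_lt_one_left hcap hc).trans_eq hzero.symm
    exact ((p.continuousAt_rateBound (hzero ▸ hcap.ne')).eventually_const_lt hlt).mono
      fun K => le_of_lt

end Params

lemma Params.StrictlyAchieves.eventually {η : ℕ} {p : Params η} {P : Fin 2 → ℝ} {N : ℝ}
    {R : Fin 2 → ℝ} (h : p.StrictlyAchieves P N R) (hR : ∀ ν, 0 ≤ R ν) :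
    ∀ᶠ K in 𝓝 0, p.TraceConstraints (P 0) (P 1) N K ∧ (R 0, R 1) ∈ p.region N K := by
  have hpower (ν : Fin 2) : ∀ᶠ K in 𝓝 0, p.inputPower N K ν < η * P ν :=
    (p.continuous_inputPower N ν).continuousAt.eventually_lt_const (h.inputPower_lt ν)
  have hrate {x : ℝ} {S : Matrix (Fin η) (Fin η) ℝ} (hx : 0 ≤ x)
      (hlt : x < p.rateBound N 0 p.C S) : ∀ᶠ K in 𝓝 0, x < p.rateBound N K p.C S :=
    (p.continuousAt_rateBound (hx.trans_lt hlt).ne').eventually_const_lt hlt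
  filter_upwards [hpower 0, hpower 1, hrate (hR 0) (h.lt_rateBound 0),
    hrate (hR 1) (h.lt_rateBound 1), hrate (add_nonneg (hR 0) (hR 1)) h.sum_lt_rateBound]
    with K hP₀ hP₁ hR₀ hR₁ hR₀₁
  exact ⟨⟨hP₀.le, hP₁.le⟩, Or.inl ⟨h.det_ne_zero, hR 0, hR 1, hR₀.le, hR₁.le, hR₀₁.le⟩⟩

lemma abs_apply_le_trace_of_posSemidef {ι : Type*} [Fintype ι] {K : Matrix ι ι ℝ}
    (hK : K.PosSemidef) (i j : ι) : |K i j| ≤ K.trace := by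
  have hdiag (l : ι) : K l l ≤ K.trace :=
    Finset.single_le_sum (f := K.diag) (fun l _ => hK.diag_nonneg) (Finset.mem_univ l)
  have hminor := (hK.submatrix ![i, j]).det_nonneg
  have hsymm : K j i = K i j := hK.isHermitian.apply i j
  simp only [Matrix.det_fin_two, Matrix.submatrix_apply, Matrix.cons_val_zero,
    Matrix.cons_val_one, hsymm] at hminor
  have htrace : 0 ≤ K.trace := hK.diag_nonneg.trans (hdiag i)
  refine abs_le_of_sq_le_sq ?_ htrace
  have := mul_le_mul (hdiag i) (hdiag j) hK.diag_nonneg htrace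
  linarith

lemma exists_forall_posSemidef_of_eventually {ι : Type*} [Fintype ι] {p : Matrix ι ι ℝ → Prop}
    (h : ∀ᶠ K in 𝓝 0, p K) : ∃ σsq > 0, ∀ K, K.PosSemidef → K.trace ≤ σsq → p K := by
  have hpi : ∀ᶠ K in 𝓝 (0 : ι → ι → ℝ), p (Matrix.of K) := h
  obtain ⟨ε, hε, hball⟩ := Metric.eventually_nhds_iff.1 hpi
  refine ⟨ε / 2, half_pos hε, fun K hK htr => hball (y := fun i j => K i j) ?_⟩
  refine (dist_pi_lt_iff hε).2 fun i => (dist_pi_lt_iff hε).2 fun j => ?_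
  rw [Pi.zero_apply, Pi.zero_apply, Real.dist_0_eq_abs]
  exact ((abs_apply_le_trace_of_posSemidef hK i j).trans htr).trans_lt (half_lt_self hε)

lemma mem_vanishingNoiseLimit {F : Matrix (Fin 2) (Fin 2) ℝ → Set (ℝ × ℝ)} {R : ℝ × ℝ}
    (h : ∀ c ∈ Set.Ico (0 : ℝ) 1, ∀ᶠ K in 𝓝 0, c • R ∈ F K) : R ∈ vanishingNoiseLimit F := by
  have hlim : Filter.Tendsto (fun c : ℝ => c • R) (𝓝[<] 1) (𝓝 R) := by
    have hcont : Continuous fun c : ℝ => c • R := by fun_prop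
    exact (hcont.tendsto' 1 R (one_smul ℝ R)).mono_left nhdsWithin_le_nhds
  refine mem_closure_of_tendsto hlim ?_
  filter_upwards [Ico_mem_nhdsLT zero_lt_one] with c hc
  obtain ⟨σsq, hσ, hK⟩ := exists_forall_posSemidef_of_eventually (h c hc)
  exact Set.mem_biUnion hσ (Set.mem_iInter₂.2 fun K hKm => hK K hKm.1 hKm.2)

/-! ### Exchanging the users -/

namespace Params

variable {η : ℕ} (p : Params η) (σ : Equiv.Perm (Fin 2)) (N : ℝ) (K : Matrix (Fin 2) (Fin 2) ℝ)

/-- The scheme obtained from `p` by relabelling the users: user `ν` takes over the role of user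
`σ ν`. -/
def permute : Params η where
  a := p.a ∘ σ
  B := p.B ∘ σ
  C := p.C
  strictLower ν := p.strictLower (σ ν)

lemma submatrix_kronecker_one :
    K.submatrix σ σ ⊗ₖ (1 : Matrix (Fin η) (Fin η) ℝ) =
      (K ⊗ₖ 1).submatrix (σ.prodCongr (.refl _)) (σ.prodCongr (.refl _)) :=
  rfl

lemma noiseCov_permute : (p.permute σ).noiseCov N (K.submatrix σ σ) = p.noiseCov N K := by
  have hBb : (p.permute σ).Bb = p.Bb.submatrix id (σ.prodCongr (.refl _)) := rfl
  simp only [noiseCov, hBb, submatrix_kronecker_one, Matrix.transpose_submatrix,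
    Matrix.submatrix_mul_equiv, Matrix.submatrix_id_id]

lemma inputCov_permute :
    (p.permute σ).inputCov N (K.submatrix σ σ) =
      (p.inputCov N K).submatrix (σ.prodCongr (.refl _)) (σ.prodCongr (.refl _)) := by
  set e : Fin 2 × Fin η ≃ Fin 2 × Fin η := σ.prodCongr (.refl _)
  have hAd : (p.permute σ).Ad = p.Ad.submatrix e σ := by
    ext x μ
    simp [Ad, permute, e]
  have hBt : (p.permute σ).Bt = p.Bt.submatrix e (Equiv.refl _) := rfl
  have hBd : (p.permute σ).Bd = p.Bd.submatrix e e := by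
    ext x y
    simp [Bd, permute, e]
  have hBB : 1 - (p.permute σ).BB = (1 - p.BB).submatrix e e := by
    rw [Matrix.submatrix_sub, Pi.sub_apply, Pi.sub_apply, Matrix.submatrix_one_equiv]
    rfl
  have hsum (X Y Z : Matrix (Fin 2 × Fin η) (Fin 2 × Fin η) ℝ) :
      X.submatrix e e + N • Y.submatrix e e + Z.submatrix e e =
        (X + N • Y + Z).submatrix e e := rfl
  have hkron : K.submatrix σ σ ⊗ₖ (1 : Matrix (Fin η) (Fin η) ℝ) =
      (K ⊗ₖ 1).submatrix e e := submatrix_kronecker_one σ K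
  simp only [inputCov, hAd, hBt, hBd, hBB, hkron, Matrix.inv_submatrix_equiv,
    Matrix.transpose_submatrix, Matrix.submatrix_mul_equiv, hsum]

lemma inputPower_permute (ν : Fin 2) :
    (p.permute σ).inputPower N (K.submatrix σ σ) ν = p.inputPower N K (σ ν) := by
  rw [inputPower, inputCov_permute]
  rfl

lemma rateBound_permute {k : ℕ} (D : Matrix (Fin k) (Fin η) ℝ) (S : Matrix (Fin η) (Fin η) ℝ) :
    (p.permute σ).rateBound N (K.submatrix σ σ) D S = p.rateBound N K D S := by
  rw [rateBound, noiseCov_permute, rateBound]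

lemma nfBound_permute (P' : ℝ) :
    (p.permute σ).nfBound P' N (K.submatrix σ σ) = p.nfBound P' N K := by
  rw [nfBound, noiseCov_permute, nfBound]

lemma Ab_mul_transpose_permute : (p.permute σ).Ab * (p.permute σ).Abᵀ = p.Ab * p.Abᵀ := by
  have hAb : (p.permute σ).Ab = p.Ab.submatrix id σ := rfl
  rw [hAb, Matrix.transpose_submatrix, Matrix.submatrix_mul_equiv, Matrix.submatrix_id_id]

variable {p N K}

lemma swap_mem_constraintSet {k : ℕ} {D : Matrix (Fin k) (Fin η) ℝ} {R : ℝ × ℝ}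
    (h : R ∈ p.constraintSet N K D) :
    R.swap ∈ (p.permute (.swap 0 1)).constraintSet N
      (K.submatrix (Equiv.swap 0 1) (Equiv.swap 0 1)) D := by
  obtain ⟨hR₁, hR₂, hle₁, hle₂, hsum⟩ := h
  simp only [constraintSet, rateBound_permute, Ab_mul_transpose_permute, Set.mem_ofPred_eq]
  exact ⟨hR₂, hR₁, hle₂, hle₁, (add_comm _ _).trans_le hsum⟩

lemma swap_mem_region {R : ℝ × ℝ} (h : R ∈ p.region N K) :
    R.swap ∈ (p.permute (.swap 0 1)).region N
      (K.submatrix (Equiv.swap 0 1) (Equiv.swap 0 1)) := by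
  rcases h with ⟨hdet, h⟩ | ⟨hdet, ν, hν, h⟩ | ⟨hC, rfl⟩
  · exact Or.inl ⟨hdet, swap_mem_constraintSet h⟩
  · exact Or.inr (Or.inl ⟨hdet, ν, hν, swap_mem_constraintSet h⟩)
  · exact Or.inr (Or.inr ⟨hC, rfl⟩)

end Params

lemma swap_mem_rateRS₂ {P₁' P₁'' P₂ N : ℝ} {K : Matrix (Fin 2) (Fin 2) ℝ} {R : ℝ × ℝ}
    (h : R ∈ rateRS₁ P₁' P₁'' P₂ N K) :
    R.swap ∈ rateRS₂ P₂ P₁' P₁'' N (K.submatrix (Equiv.swap 0 1) (Equiv.swap 0 1)) := by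
  refine map_mem_closure continuous_swap h ?_
  rintro R ⟨η, p, hη, ⟨hpow₁, hpow₂⟩, Rcs, Rnf, hcs, hnf, hadd, hmem, hle⟩
  refine ⟨η, p.permute (.swap 0 1), hη, ⟨?_, ?_⟩, Rcs, Rnf, hcs, hnf, hadd,
    Params.swap_mem_region hmem, (p.nfBound_permute _ _ _ _).symm ▸ hle⟩
  · exact (p.inputPower_permute _ _ _ 0).trans_le hpow₂
  · exact (p.inputPower_permute _ _ _ 1).trans_le hpow₁

lemma map_mem_vanishingNoiseLimit {F G : Matrix (Fin 2) (Fin 2) ℝ → Set (ℝ × ℝ)}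
    {f : ℝ × ℝ → ℝ × ℝ} (hf : Continuous f) (σ : Equiv.Perm (Fin 2))
    (h : ∀ K, ∀ R ∈ F K, f R ∈ G (K.submatrix σ σ)) {R : ℝ × ℝ} (hR : R ∈ vanishingNoiseLimit F) :
    f R ∈ vanishingNoiseLimit G := by
  refine map_mem_closure hf hR fun R hR => ?_
  simp only [Set.mem_iUnion₂, Set.mem_iInter₂] at hR ⊢
  obtain ⟨σsq, hσsq, hmem⟩ := hR
  refine ⟨σsq, hσsq, fun K ⟨hK, htr⟩ => ?_⟩
  have htrace : (K.submatrix σ.symm σ.symm).trace = K.trace := σ.symm.sum_comp K.diag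
  simpa using h _ R (hmem (K.submatrix σ.symm σ.symm) ⟨hK.submatrix _, htrace.trans_le htr⟩)

/-! ### Rate splitting -/

lemma awgnCap_add_div {x y N : ℝ} (hx : 0 ≤ x) (hy : 0 ≤ y) (hN : 0 < N) :
    awgnCap ((x + y) / N) = awgnCap (x / (N + y)) + awgnCap (y / N) := by
  have hx' : 1 + x / (N + y) ≠ 0 := by positivity
  have hy' : 1 + y / N ≠ 0 := by positivity
  rw [awgnCap, awgnCap, awgnCap, ← mul_add, ← Real.log_mul hx' hy']
  congr 2
  field_simp
  ring

lemma exists_add_eq_of_le_add {R I J : ℝ} (hR : 0 ≤ R) (hI : 0 ≤ I) (hJ : 0 ≤ J)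
    (h : R ≤ I + J) : ∃ s ∈ Set.Icc 0 I, ∃ t ∈ Set.Icc 0 J, s + t = R := by
  refine ⟨min R I, ⟨le_min hR hI, min_le_right _ _⟩, R - min R I,
    ⟨sub_nonneg.2 (min_le_left _ _), ?_⟩, by ring⟩
  rw [sub_le_comm]
  exact le_min (by linarith) (by linarith)

/-- The scheme of block length one without feedback, in which user `ν` sends its symbol with
amplitude `a ν`. -/
def uncodedScheme (a : Fin 2 → ℝ) : Params 1 where
  a ν _ := a ν
  B _ := 0
  C := Matrix.of fun _ _ => 1
  strictLower _ _ _ _ := rfl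

section uncodedScheme

variable (a : Fin 2 → ℝ) (N : ℝ) (K : Matrix (Fin 2) (Fin 2) ℝ)

lemma noiseCov_uncodedScheme : (uncodedScheme a).noiseCov N K = N • 1 := by
  have hBb : (uncodedScheme a).Bb = 0 := rfl
  rw [Params.noiseCov, hBb, Matrix.zero_mul, Matrix.zero_mul, add_zero]

lemma inputPower_uncodedScheme (ν : Fin 2) : (uncodedScheme a).inputPower N K ν = a ν ^ 2 := by
  have hBB : (uncodedScheme a).BB = 0 := rfl
  have hBt : (uncodedScheme a).Bt = 0 := rfl
  have hBd : (uncodedScheme a).Bd = 0 := by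
    ext x y
    simp [Params.Bd, uncodedScheme]
  have hcov : (uncodedScheme a).inputCov N K = (uncodedScheme a).Ad * (uncodedScheme a).Adᵀ := by
    simp [Params.inputCov, hBB, hBt, hBd]
  rw [Params.inputPower, hcov]
  simp [Matrix.trace, Matrix.mul_apply, Params.Ad, uncodedScheme, sq]

variable {N}

lemma rateBound_uncodedScheme (hN : N ≠ 0) (S : Matrix (Fin 1) (Fin 1) ℝ) :
    (uncodedScheme a).rateBound N K (1 : Matrix (Fin 1) (Fin 1) ℝ) S = awgnCap (S 0 0 / N) := by
  rw [Params.rateBound, noiseCov_uncodedScheme]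
  simp [awgnCap, add_div, div_self hN, add_comm]

variable {a}

lemma mem_region_uncodedScheme (hN : N ≠ 0) {R : ℝ × ℝ} (hR₁ : 0 ≤ R.1) (hR₂ : 0 ≤ R.2)
    (hle₁ : R.1 ≤ awgnCap (a 0 ^ 2 / N)) (hle₂ : R.2 ≤ awgnCap (a 1 ^ 2 / N))
    (hsum : R.1 + R.2 ≤ awgnCap ((a 0 ^ 2 + a 1 ^ 2) / N)) :
    R ∈ (uncodedScheme a).region N K := by
  have hrow : (Matrix.of fun _ : Fin 1 => (uncodedScheme a).C 0) = 1 := by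
    ext i j
    rw [Subsingleton.elim i j, Matrix.one_apply_eq]
    rfl
  refine Or.inr (Or.inl ⟨?_, 0, fun h => one_ne_zero (congrFun h 0), ?_⟩)
  · simp [Matrix.det_fin_two, Matrix.mul_apply, uncodedScheme]
  · simp only [hrow, Params.constraintSet, rateBound_uncodedScheme a K hN, Set.mem_ofPred_eq]
    refine ⟨hR₁, hR₂, ?_, ?_, ?_⟩
    · simpa [Matrix.vecMulVec_apply, uncodedScheme, sq] using hle₁
    · simpa [Matrix.vecMulVec_apply, uncodedScheme, sq] using hle₂
    · simpa [Matrix.mul_apply, Params.Ab, uncodedScheme, sq] using hsum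

end uncodedScheme

section

variable {P₁ P₂ N ρ : ℝ}

lemma ozRect₁_zero_subset_rateRS₁ (hP₁ : 0 ≤ P₁) (hP₂ : 0 ≤ P₂) (hN : 0 < N)
    (K : Matrix (Fin 2) (Fin 2) ℝ) : ozRect₁ P₁ P₂ N 0 ⊆ rateRS₁ P₁ 0 P₂ N K := by
  intro R hR
  obtain ⟨hR₁, hR₂, hle₁, hle₂⟩ :=
    (mem_ozRect₁_iff hP₁ hP₂ hN (Set.left_mem_Icc.2 zero_le_one)).1 hR
  have hN' : N + P₁ ≠ 0 := by positivity
  have hsq : √P₂ ^ 2 = P₂ := Real.sq_sqrt hP₂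
  have hcap : R.2 ≤ awgnCap (P₂ / (N + P₁)) := by
    have hchain := awgnCap_add_div hP₂ hP₁ hN
    rw [add_comm P₂] at hchain
    simp only [mul_zero, add_zero, zero_pow two_ne_zero, sub_zero, mul_one] at hle₂
    linarith
  refine subset_closure ⟨1, uncodedScheme ![0, √P₂], one_pos,
    ⟨(inputPower_uncodedScheme _ _ K 0).trans_le (by simp),
      (inputPower_uncodedScheme _ _ K 1).trans_le (by simp [hsq])⟩,
    0, R.1, le_rfl, hR₁, zero_add _,
    mem_region_uncodedScheme K hN' le_rfl hR₂ ?_ ?_ ?_, ?_⟩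
  · exact awgnCap_nonneg (by simp)
  · simpa [hsq] using hcap
  · simpa [hsq] using hcap
  · rw [Params.nfBound_of_noiseCov_eq _ one_pos hN.ne' (noiseCov_uncodedScheme _ _ _)]
    simpa using hle₁

/-- Successive decoding: the part of message `1` sent without feedback acts as additional noise on
the rest of the transmission. -/
lemma mem_ozRect₁_iff_of_power_split {Q r : ℝ} (hP₂ : 0 ≤ P₂) (hN : 0 < N)
    (hρ : ρ ∈ Set.Icc (0 : ℝ) 1) (hQ : Q ∈ Set.Icc 0 P₁) (hr : r ∈ Set.Icc (0 : ℝ) 1)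
    (hQr : Q * r ^ 2 = P₁ * ρ ^ 2) (hsqrt : √(Q * P₂) * r = √(P₁ * P₂) * ρ)
    (h : RhoEq Q P₂ (N + (P₁ - Q)) r) {R : ℝ × ℝ} :
    R ∈ ozRect₁ P₁ P₂ N ρ ↔ 0 ≤ R.1 ∧ 0 ≤ R.2 ∧
      R.1 ≤ awgnCap (Q * (1 - r ^ 2) / (N + (P₁ - Q))) + awgnCap ((P₁ - Q) / N) ∧
      R.2 ≤ awgnCap (P₂ * (1 - r ^ 2) / (N + (P₁ - Q))) := by
  have hQ0 := hQ.1
  have hr0 := hr.1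
  have hr1 : r ^ 2 ≤ 1 := pow_le_one₀ hr0 hr.2
  have : 0 ≤ 1 - r ^ 2 := sub_nonneg.2 hr1
  have hP' : 0 ≤ P₁ - Q := sub_nonneg.2 hQ.2
  have hcap₁ : awgnCap (P₁ * (1 - ρ ^ 2) / N) =
      awgnCap (Q * (1 - r ^ 2) / (N + (P₁ - Q))) + awgnCap ((P₁ - Q) / N) := by
    rw [← awgnCap_add_div (by positivity) hP' hN]
    congr 2
    linear_combination hQr
  have hcap₂ : awgnCap ((P₁ + P₂ + 2 * √(P₁ * P₂) * ρ) / N) =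
      awgnCap (Q * (1 - r ^ 2) / (N + (P₁ - Q))) + awgnCap (P₂ * (1 - r ^ 2) / (N + (P₁ - Q))) +
        awgnCap ((P₁ - Q) / N) := by
    rw [← h.awgnCap_sum_eq hQ0 hP₂ (by positivity) hr1, ← awgnCap_add_div (by positivity) hP' hN]
    congr 2
    linear_combination -2 * hsqrt
  rw [mem_ozRect₁_iff (hQ0.trans hQ.2) hP₂ hN hρ, hcap₁, hcap₂, add_right_comm,
    add_sub_cancel_left]

lemma eventually_smul_mem_rateRS₁ {P₁' P₁'' r c : ℝ} (hP' : 0 ≤ P₁') (hP'' : 0 < P₁'')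
    (hP₂ : 0 < P₂) (hN : 0 < N) (hr : r ∈ Set.Ioo (0 : ℝ) 1) (h : RhoEq P₁'' P₂ (N + P₁') r)
    {R : ℝ × ℝ} (hR₁ : 0 ≤ R.1) (hR₂ : 0 ≤ R.2)
    (hle₁ : R.1 ≤ awgnCap (P₁'' * (1 - r ^ 2) / (N + P₁')) + awgnCap (P₁' / N))
    (hle₂ : R.2 ≤ awgnCap (P₂ * (1 - r ^ 2) / (N + P₁'))) (hc : c ∈ Set.Ico (0 : ℝ) 1) :
    ∀ᶠ K in 𝓝 0, c • R ∈ rateRS₁ P₁' P₁'' P₂ N K := by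
  have hN' : 0 < N + P₁' := by positivity
  have hsq : 0 < 1 - r ^ 2 := sub_pos.2 (pow_lt_one₀ hr.1.le hr.2 two_ne_zero)
  have hcap {P : ℝ} (hP : 0 < P) : 0 < awgnCap (P * (1 - r ^ 2) / (N + P₁')) :=
    awgnCap_pos (by positivity)
  have hlt {x y : ℝ} (hy : 0 < y) (hle : x ≤ y) : c * x < y :=
    (mul_le_mul_of_nonneg_left hle hc.1).trans_lt (mul_lt_of_lt_one_left hy hc.2)
  obtain ⟨s, hs, t, ht, hst⟩ :=
    exists_add_eq_of_le_add hR₁ (hcap hP'').le (awgnCap_nonneg (by positivity)) hle₁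
  obtain ⟨η, hη, p, hp⟩ := exists_strictlyAchieves (P := ![P₁'', P₂])
    (R := ![c * s, c * R.2]) (Fin.forall_fin_two.2 ⟨hP'', hP₂⟩) hN' hr h
    (Fin.forall_fin_two.2 ⟨hlt (hcap hP'') hs.2, hlt (hcap hP₂) hle₂⟩)
  filter_upwards [
    hp.eventually (Fin.forall_fin_two.2 ⟨mul_nonneg hc.1 hs.1, mul_nonneg hc.1 hR₂⟩),
    p.eventually_mul_awgnCap_le_nfBound hη hP' hN hc.2]
    with K ⟨htrace, hmem⟩ hnf
  exact subset_closure ⟨η, p, hη, htrace, c * s, c * t, mul_nonneg hc.1 hs.1,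
    mul_nonneg hc.1 ht.1, by rw [← mul_add, hst]; rfl, hmem,
    (mul_le_mul_of_nonneg_left ht.2 hc.1).trans hnf⟩

variable (hP₁ : 0 < P₁) (hP₂ : 0 < P₂) (hN : 0 < N)

include hP₁ hP₂ hN

lemma exists_ozRect₁_subset (hρ : ρ ∈ Set.Icc 0 (rhoStar P₁ P₂ N)) :
    ∃ P₁' ∈ Set.Icc 0 P₁, ozRect₁ P₁ P₂ N ρ ⊆
      vanishingNoiseLimit fun K => rateRS₁ P₁' (P₁ - P₁') P₂ N K := by
  rcases hρ.1.eq_or_lt with rfl | hρ0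
  · refine ⟨P₁, ⟨hP₁.le, le_rfl⟩, fun R hR => subset_closure ?_⟩
    rw [sub_self]
    exact Set.mem_biUnion (Set.mem_Ioi.2 one_pos) (Set.mem_iInter₂.2 fun K _ =>
      ozRect₁_zero_subset_rateRS₁ hP₁.le hP₂.le hN K hR)
  · obtain ⟨Q, hQ, r, hr, hQr, hsqrt, hrho⟩ := exists_power_split hP₁ hP₂ hN ⟨hρ0, hρ.2⟩
    have hρ1 : ρ ∈ Set.Icc (0 : ℝ) 1 := ⟨hρ.1, hρ.2.trans (rhoStar_spec hP₁ hP₂ hN).1.2⟩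
    have hP' : 0 ≤ P₁ - Q := sub_nonneg.2 hQ.2
    refine ⟨P₁ - Q, ⟨hP', sub_le_self _ hQ.1.le⟩, fun R hR => mem_vanishingNoiseLimit ?_⟩
    rw [sub_sub_cancel]
    obtain ⟨hR₁, hR₂, hle₁, hle₂⟩ :=
      (mem_ozRect₁_iff_of_power_split hP₂.le hN hρ1 (Set.Ioc_subset_Icc_self hQ)
        (Set.Ioo_subset_Icc_self hr) hQr hsqrt hrho).1 hR
    exact fun c hc => eventually_smul_mem_rateRS₁ hP' hQ.1 hP₂ hN hr hrho hR₁ hR₂ hle₁ hle₂ hc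

lemma exists_ozRect₂_subset (hρ : ρ ∈ Set.Icc 0 (rhoStar P₁ P₂ N)) :
    ∃ P₂' ∈ Set.Icc 0 P₂, ozRect₂ P₁ P₂ N ρ ⊆
      vanishingNoiseLimit fun K => rateRS₂ P₁ P₂' (P₂ - P₂') N K := by
  rw [← rhoStar_comm hP₁ hP₂ hN] at hρ
  obtain ⟨P₂', hP₂', hsub⟩ := exists_ozRect₁_subset hP₂ hP₁ hN hρ
  refine ⟨P₂', hP₂', fun R hR => ?_⟩
  rw [ozRect₂_eq_preimage_swap] at hR
  exact map_mem_vanishingNoiseLimit continuous_swap (.swap 0 1)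
    (fun _ _ => swap_mem_rateRS₂) (hsub hR)

lemma exists_mem_ozRect_of_mem_frontier {R : ℝ × ℝ} (hR : R ∈ frontier (capPerfectFB P₁ P₂ N)) :
    ∃ ρ ∈ Set.Icc 0 (rhoStar P₁ P₂ N), R ∈ ozRect₁ P₁ P₂ N ρ ∨ R ∈ ozRect₂ P₁ P₂ N ρ := by
  have hclosed : IsClosed ({R : ℝ × ℝ | 0 ≤ R.1 ∧ 0 ≤ R.2} ∩ ozOuter P₁ P₂ N) :=
    .inter ((isClosed_le continuous_const continuous_fst).inter
      (isClosed_le continuous_const continuous_snd)) (isClosed_ozOuter hP₁.le hP₂.le hN.le)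
  have hsub : capPerfectFB P₁ P₂ N ⊆ {R : ℝ × ℝ | 0 ≤ R.1 ∧ 0 ≤ R.2} ∩ ozOuter P₁ P₂ N :=
    fun R hR => ⟨⟨hR.1, hR.2.1⟩, capPerfectFB_subset_ozOuter hP₁ hP₂ hN hR⟩
  obtain ⟨⟨hR₁, hR₂⟩, hmem⟩ := closure_minimal hsub hclosed (frontier_subset_closure hR)
  exact exists_mem_ozRect hP₁ hP₂ hN hR₁ hR₂ hmem

end

end AWGNMAC

end

theorem mainTheorem8 (P₁ P₂ N : ℝ) (hP₁ : 0 < P₁) (hP₂ : 0 < P₂) (hN : 0 < N) :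
    (∀ ρ ∈ Set.Icc 0 (AWGNMAC.rhoStar P₁ P₂ N), ∃ P₁' ∈ Set.Icc 0 P₁,
      AWGNMAC.ozRect₁ P₁ P₂ N ρ ⊆
        AWGNMAC.vanishingNoiseLimit fun K => AWGNMAC.rateRS₁ P₁' (P₁ - P₁') P₂ N K) ∧
    (∀ ρ ∈ Set.Icc 0 (AWGNMAC.rhoStar P₁ P₂ N), ∃ P₂' ∈ Set.Icc 0 P₂,
      AWGNMAC.ozRect₂ P₁ P₂ N ρ ⊆
        AWGNMAC.vanishingNoiseLimit fun K => AWGNMAC.rateRS₂ P₁ P₂' (P₂ - P₂') N K) ∧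
    (∀ R ∈ frontier (AWGNMAC.capPerfectFB P₁ P₂ N),
      (∃ P₁' ∈ Set.Icc 0 P₁,
        R ∈ AWGNMAC.vanishingNoiseLimit fun K => AWGNMAC.rateRS₁ P₁' (P₁ - P₁') P₂ N K) ∨
      (∃ P₂' ∈ Set.Icc 0 P₂,
        R ∈ AWGNMAC.vanishingNoiseLimit fun K => AWGNMAC.rateRS₂ P₁ P₂' (P₂ - P₂') N K)) := by
  refine ⟨fun ρ hρ => AWGNMAC.exists_ozRect₁_subset hP₁ hP₂ hN hρ,
    fun ρ hρ => AWGNMAC.exists_ozRect₂_subset hP₁ hP₂ hN hρ, fun R hR => ?_⟩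
  obtain ⟨ρ, hρ, h | h⟩ := AWGNMAC.exists_mem_ozRect_of_mem_frontier hP₁ hP₂ hN hR
  · obtain ⟨P', hP', hsub⟩ := AWGNMAC.exists_ozRect₁_subset hP₁ hP₂ hN hρ
    exact Or.inl ⟨P', hP', hsub h⟩
  · obtain ⟨P', hP', hsub⟩ := AWGNMAC.exists_ozRect₂_subset hP₁ hP₂ hN hρ
    exact Or.inr ⟨P', hP', hsub h⟩
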